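/- Let $L\in\mathbb N$. For each hop $j\in\{1,2\}$ let $a_{i}^{(j)}\in\mathbb R$, $b_{i}^{(j)}\in\mathbb R$, $c_{i}^{(j)}>0$ ($1\le i\le L$), $\xi_j>0$, $A_{0_j}>0$, $\bar\gamma_j>0$, and put $\alpha_i^{(j)}=c_i^{(j)}/(A_{0_j}\bar\gamma_j)$. Assume that $\xi_j^2$ is an integer and that $d_i^{(j)}:=b_i^{(j)}-\xi_j^2$ is a positive integer for all $i,j$. Let $\gamma_1,\gamma_2$ be independent positive random variables (the received SNRs of the two hops), where $\gamma_j$ has the probability density $$f_{\gamma_j}(x)=\sum_{i=1}^{L}\frac{a_i^{(j)}\,(c_i^{(j)})^{\xi_j^2-b_i^{(j)}}\,\xi_j^2\,x^{\xi_j^2-1}}{(A_{0_j}\bar\gamma_j)^{\xi_j^2}}\;\Gamma\!\left(b_i^{(j)}-\xi_j^2,\ \alpha_i^{(j)}x\right),\qquad x>0,$$ with $\Gamma(s,x)=\int_x^\infty t^{s-1}e^{-t}\,dt$. Let $\gamma_{\rm CSI}=\gamma_1\gamma_2/(\gamma_1+\gamma_2)$ be the end-to-end SNR of CSI-assisted amplify-and-forward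 relaying with $q=0$ and $F_{\gamma_{\rm CSI}}$ its cumulative distribution function. Let $P,Q>0$ and let $$\overline P_b=\frac{Q^P}{2\Gamma(P)}\int_0^\infty z^{P-1}e^{-Qz}F_{\gamma_{\rm CSI}}(z)\,dz$$ be the average bit-error rate. Set $$\Xi_j(i,k)=\frac{a_i^{(j)}\,(c_i^{(j)})^{\xi_j^2-b_i^{(j)}+k}\,\xi_j^2\,(d_i^{(j)}-1)!}{k!\,(A_{0_j}\bar\gamma_j)^{\xi_j^2+k}}.$$ Then the integral converges absolutely and $$\overline P_b=\frac12-\sum_{i_1=1}^{L}\ \sum_{k_1=0}^{d_{i_1}^{(1)}-1}\ \sum_{r=0}^{\xi_1^2+k_1-1}\ \sum_{i_2=1}^{L}\ \sum_{k_2=0}^{d_{i_2}^{(2)}-1}\ \sum_{p=0}^{\xi_2^2+k_2-1}\ \sum_{s=0}^{r}\binom{r}{s}\binom{\xi_2^2+k_2-1}{p}\,\frac{Q^P}{\Gamma(P)}\;T,$$ where, writing $a=\alpha_{i_1}^{(1)}$, $b=\alpha_{i_2}^{(2)}$ and $N=\xi_2^2+k_2+r$, $$T=\frac{\Xi_1(i_1,k_1)\,\Xi_2(i_2,k_2)\,(\xi_1^2+k_1-1)!\,\sqrt\pi\;4^{p-s+1}\,a^{\,p-s+r-\xi_1^2-k_1+1}\,\Gamma(N+p-s+P+1)\,\Gamma(N-p+s+P-1)}{r!\,\left(a+b+Q+2\sqrt{ab}\right)^{N+p-s+P+1}\,\Gamma\!\left(N+P+\tfrac12\right)}$$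 $$\qquad\times\ {}_2F_1\!\left(N+p-s+P+1,\ p-s+\tfrac32;\ N+P+\tfrac12;\ \frac{a+b+Q-2\sqrt{ab}}{a+b+Q+2\sqrt{ab}}\right).$$ -/

import Mathlib

open MeasureTheory ProbabilityTheory

noncomputable section

namespace FSO

/-- Upper incomplete Gamma function `Γ(s, x) = ∫_x^∞ t ^ (s - 1) e ^ (-t) dt` (for `x > 0`). -/
def upperGamma (s x : ℝ) : ℝ :=
  ∫ t in Set.Ioi x, t ^ (s - 1) * Real.exp (-t)

/-- Parameters of one free-space optical hop: mixture-Gamma turbulence with `L` components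
(parameters `a i`, `b i`, `c i`), pointing-error ratio `ξ`, pointing-loss constant `A0`, and average
received SNR `avgSNR`. -/
structure Hop (L : ℕ) where
  a : Fin L → ℝ
  b : Fin L → ℝ
  c : Fin L → ℝ
  ξ : ℝ
  A0 : ℝ
  avgSNR : ℝ
  c_pos : ∀ i, 0 < c i
  ξ_pos : 0 < ξ
  A0_pos : 0 < A0
  avgSNR_pos : 0 < avgSNR

variable {L : ℕ}

/-- The exponential rate `c_i / (A₀ γ̄)` of the `i`-th mixture component. -/
def Hop.rate (h : Hop L) (i : Fin L) : ℝ :=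
  h.c i / (h.A0 * h.avgSNR)

/-- The probability density of the SNR of a hop at `x > 0` (mixture-Gamma fading combined with
zero-boresight pointing errors, heterodyne detection). -/
def Hop.snrPDF (h : Hop L) (x : ℝ) : ℝ :=
  ∑ i, h.a i * h.c i ^ (h.ξ ^ 2 - h.b i) * h.ξ ^ 2 * x ^ (h.ξ ^ 2 - 1)
    / (h.A0 * h.avgSNR) ^ (h.ξ ^ 2) * upperGamma (h.b i - h.ξ ^ 2) (h.rate i * x)

/-- The random variable `γ` is the received SNR of the hop `h`: `h.snrPDF` is nonnegative on
`(0, ∞)`, and the law of `γ` is concentrated on `(0, ∞)` with density `h.snrPDF` there. -/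
structure Hop.IsSNR (h : Hop L) {Ω : Type*} [MeasurableSpace Ω] (μ : Measure Ω) (γ : Ω → ℝ) :
    Prop where
  measurable : Measurable γ
  pdf_nonneg : ∀ x, 0 < x → 0 ≤ h.snrPDF x
  map_eq : μ.map γ =
    (volume.restrict (Set.Ioi (0 : ℝ))).withDensity (fun x => ENNReal.ofReal (h.snrPDF x))

/-- The end-to-end SNR `γ₁ γ₂ / (γ₁ + γ₂ + q)` of CSI-assisted amplify-and-forward relaying. -/
def csiSNR {Ω : Type*} (q : ℝ) (γ₁ γ₂ : Ω → ℝ) (ω : Ω) : ℝ :=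
  γ₁ ω * γ₂ ω / (γ₁ ω + γ₂ ω + q)

/-- The integrand `z ^ (P - 1) e ^ (-Q z) F(z)` of the average bit-error rate. -/
def aberIntegrand (P Q : ℝ) (F : ℝ → ℝ) (z : ℝ) : ℝ :=
  z ^ (P - 1) * Real.exp (-Q * z) * F z

/-- The average bit-error rate of an SNR with cumulative distribution function `F`, for the
modulation parameters `P`, `Q`. -/
def aber (P Q : ℝ) (F : ℝ → ℝ) : ℝ :=
  Q ^ P / (2 * Real.Gamma P) * ∫ z in Set.Ioi (0 : ℝ), aberIntegrand P Q F z

/-- The coefficient `Ξ(i)` (depending also on `k`), where the natural number `d i` is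
`b_i - ξ²`. -/
def Hop.Xi (h : Hop L) (d : Fin L → ℕ) (i : Fin L) (k : ℕ) : ℝ :=
  h.a i * h.c i ^ (h.ξ ^ 2 - h.b i + k) * h.ξ ^ 2 * (Nat.factorial (d i - 1) : ℝ)
    / ((Nat.factorial k : ℝ) * (h.A0 * h.avgSNR) ^ (h.ξ ^ 2 + k))

end FSO

end

/-! Since `F = 1 - P(γ > z)`, the error rate is `1/2` minus a Gamma-weighted integral of the tail of
the end-to-end SNR. Conditioning on `γ₂ = y`, the event `z < γ₁ y / (γ₁ + y)` means `y > z` and `γ₁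
> z y / (y - z)`. With `y = z (1 + t)` the threshold becomes `z (1 + 1 / t)`, so the tail is `z ∫
f₂(z (1 + t)) T₁(z (1 + 1 / t)) dt`, where `T₁` is the tail of `γ₁` (`FSO.measureReal_lt_csiSNR`).

For integer parameters `f₂` and `T₁` are finite combinations of monomials times exponentials.
Binomial expansion leaves the double integrals of `z ^ (μ - 1) * exp (-(α + b t + a / t) z) * t ^ (ν
- 1)`, with `μ = N + P`, `ν = p - s + 1`, `α = a + b + Q`. Integrating over `z` first gives `Γ(μ) ∫
t ^ (ν - 1) (α + b t + a / t) ^ (-μ) dt`, with no need for Bessel functions.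

This integral is evaluated in `integral_rpow_mul_add_rpow`. Put `σ = √(a b)`, `t = √(a / b) τ`, `y =
4 τ / (1 + τ) ^ 2` and `x = (α - 2σ) / (α + 2σ)`. The base becomes a multiple of `(1 + τ) ^ 2 / τ *
(1 - x (1 - y))`, so what remains is the mean of `(1 - x (1 - y)) ^ (-μ)` under a Beta weight.
Multiplied by `(1 - x) ^ (-ν)`, it is expanded in powers of `x` and integrated termwise: the Beta
moments of `y` and two Vandermonde summations turn the coefficients into those of the Gauss series.
-/

/-! ### Rising factorials and Vandermonde summation -/

theorem factorial_mul_multichoose (a : ℝ) (n : ℕ) :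
    (n.factorial : ℝ) * Ring.multichoose a n = (ascPochhammer ℝ n).eval a := by
  have := Ring.factorial_nsmul_multichoose_eq_ascPochhammer a n
  rwa [nsmul_eq_mul, Polynomial.ascPochhammer_smeval_eq_eval] at this

theorem multichoose_eq_div (a : ℝ) (n : ℕ) :
    Ring.multichoose a n = (ascPochhammer ℝ n).eval a / n.factorial := by
  rw [← factorial_mul_multichoose, mul_div_cancel_left₀]
  positivity

theorem ascPochhammer_eval_add (a : ℝ) (j k : ℕ) :
    (ascPochhammer ℝ (j + k)).eval a =
      (ascPochhammer ℝ j).eval a * (ascPochhammer ℝ k).eval (a + j) := by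
  rw [← ascPochhammer_mul]
  simp

theorem multichoose_mul_multichoose (a : ℝ) (j k : ℕ) :
    Ring.multichoose a (j + k) * ((j + k).choose j : ℝ) =
      Ring.multichoose a j * Ring.multichoose (a + j) k := by
  have h1 := Nat.choose_mul_factorial_mul_factorial (Nat.le_add_right j k)
  rw [Nat.add_sub_cancel_left] at h1
  have h2 : ((j + k).choose j : ℝ) * j.factorial * k.factorial = (j + k).factorial := by
    exact_mod_cast h1
  have hj : (j.factorial : ℝ) ≠ 0 := by positivity
  have hk : (k.factorial : ℝ) ≠ 0 := by positivity
  have hjk : ((j + k).factorial : ℝ) ≠ 0 := by positivity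
  rw [multichoose_eq_div, multichoose_eq_div, multichoose_eq_div, ascPochhammer_eval_add]
  field_simp
  linear_combination (Polynomial.eval a (ascPochhammer ℝ j)) *
    (Polynomial.eval (a + j) (ascPochhammer ℝ k)) * h2

theorem choose_neg_eq (a : ℝ) (n : ℕ) :
    Ring.choose (-a) n = (-1) ^ n * Ring.multichoose a n := by
  rw [Ring.choose_neg', Ring.multichoose_eq]
  simp [Units.smul_def, Int.negOnePow]

/-- Vandermonde's identity at `-a` and `-b`; the signs combine to `(-1) ^ n` on both sides. -/
theorem multichoose_add (a b : ℝ) (n : ℕ) :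
    ∑ ij ∈ Finset.HasAntidiagonal.antidiagonal n, Ring.multichoose a ij.1 * Ring.multichoose b ij.2 =
      Ring.multichoose (a + b) n := by
  have h := Ring.add_choose_eq n (Commute.all (-a) (-b))
  rw [← neg_add, choose_neg_eq] at h
  have h1 : ((-1 : ℝ) ^ n) * (-1) ^ n = 1 := by rw [← mul_pow]; simp
  calc _ = (-1) ^ n * ∑ ij ∈ Finset.HasAntidiagonal.antidiagonal n,
        Ring.choose (-a) ij.1 * Ring.choose (-b) ij.2 := by
        rw [Finset.mul_sum]
        refine Finset.sum_congr rfl fun ij hij => ?_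
        rw [Finset.HasAntidiagonal.mem_antidiagonal] at hij
        rw [choose_neg_eq, choose_neg_eq]
        rw [← hij, pow_add] at h1 ⊢
        linear_combination -(Ring.multichoose a ij.1 * Ring.multichoose b ij.2) * h1
    _ = _ := by rw [← h, ← mul_assoc, h1, one_mul]

/-- A form of the Chu-Vandermonde identity. -/
theorem sum_multichoose_mul_multichoose_add (q c : ℝ) (n : ℕ) :
    ∑ jk ∈ Finset.HasAntidiagonal.antidiagonal n,
      (-1) ^ jk.1 * Ring.multichoose q jk.1 * Ring.multichoose (c + jk.1) jk.2 =
      Ring.multichoose (c - q) n := by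
  -- The upper argument `c + n - 1` is chosen because, for `j + k = n`, the multichoose of `c + j`
  -- at `k` is the binomial coefficient of `c + n - 1` over `k`, whose top does not depend on `j`.
  have h := Ring.add_choose_eq n (Commute.all (-q) (c + n - 1))
  rw [show -q + (c + n - 1) = (c - q) + n - 1 by ring, ← Ring.multichoose_eq] at h
  rw [h]
  refine Finset.sum_congr rfl fun jk hjk => ?_
  rw [Finset.HasAntidiagonal.mem_antidiagonal] at hjk
  rw [choose_neg_eq, Ring.multichoose_eq (c + jk.1), ← hjk]
  push_cast
  ring_nf

/-- The coefficients of the Pfaff-Euler transformation of the Gauss hypergeometric series. -/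
theorem sum_antidiagonal_hypergeometric (μ ν : ℝ) (hμ : 0 < μ) (Y : ℕ → ℝ)
    (hY : ∀ j, Y j * (ascPochhammer ℝ j).eval μ * (ascPochhammer ℝ j).eval (μ + 1 / 2) =
      Y 0 * (ascPochhammer ℝ j).eval (μ + ν) * (ascPochhammer ℝ j).eval (μ - ν)) (n : ℕ) :
    ∑ il ∈ Finset.HasAntidiagonal.antidiagonal n, Ring.multichoose ν il.1 * (Ring.multichoose μ il.2 *
        ∑ jk ∈ Finset.HasAntidiagonal.antidiagonal il.2, ((-1) ^ jk.1 * (il.2.choose jk.1 : ℝ) * Y jk.1)) =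
      Y 0 * ((n.factorial : ℝ)⁻¹ * (ascPochhammer ℝ n).eval (μ + ν) *
        (ascPochhammer ℝ n).eval (ν + 1 / 2) * ((ascPochhammer ℝ n).eval (μ + 1 / 2))⁻¹) := by
  have hc : ∀ j, (ascPochhammer ℝ j).eval (μ + 1 / 2) ≠ 0 := fun j =>
    (ascPochhammer_pos j _ (by positivity)).ne'
  have hf : ∀ j : ℕ, (j.factorial : ℝ) ≠ 0 := fun j => by positivity
  calc _ = ∑ il ∈ Finset.HasAntidiagonal.antidiagonal n, ∑ jk ∈ Finset.HasAntidiagonal.antidiagonal il.2,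
          (-1) ^ jk.1 * Y jk.1 * Ring.multichoose μ jk.1 *
            (Ring.multichoose ν il.1 * Ring.multichoose (μ + jk.1) jk.2) := by
        refine Finset.sum_congr rfl fun il _ => ?_
        rw [Finset.mul_sum, Finset.mul_sum]
        refine Finset.sum_congr rfl fun jk hjk => ?_
        rw [Finset.HasAntidiagonal.mem_antidiagonal] at hjk
        have := multichoose_mul_multichoose μ jk.1 jk.2
        rw [← hjk]
        linear_combination (-1) ^ jk.1 * Y jk.1 * Ring.multichoose ν il.1 * this
    -- Regroup the triples `i + j + k = n` with `j` outermost, so that the sum over `i + k` is a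
    -- Vandermonde convolution.
    _ = ∑ jr ∈ Finset.HasAntidiagonal.antidiagonal n, ∑ ik ∈ Finset.HasAntidiagonal.antidiagonal jr.2,
          (-1) ^ jr.1 * Y jr.1 * Ring.multichoose μ jr.1 *
            (Ring.multichoose ν ik.1 * Ring.multichoose (μ + jr.1) ik.2) := by
        rw [Finset.sum_sigma', Finset.sum_sigma']
        refine Finset.sum_bij' (fun x _ => ⟨(x.2.1, x.1.1 + x.2.2), (x.1.1, x.2.2)⟩)
          (fun x _ => ⟨(x.2.1, x.1.1 + x.2.2), (x.1.1, x.2.2)⟩) ?_ ?_ ?_ ?_ ?_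
        · rintro ⟨⟨i, l⟩, ⟨j, k⟩⟩ h
          simp only [Finset.mem_sigma, Finset.HasAntidiagonal.mem_antidiagonal, and_true] at h ⊢
          omega
        · rintro ⟨⟨i, l⟩, ⟨j, k⟩⟩ h
          simp only [Finset.mem_sigma, Finset.HasAntidiagonal.mem_antidiagonal, and_true] at h ⊢
          omega
        · rintro ⟨⟨i, l⟩, ⟨j, k⟩⟩ h
          simp only [Finset.mem_sigma, Finset.HasAntidiagonal.mem_antidiagonal] at h
          obtain ⟨h1, h2⟩ := h
          subst h2
          rfl
        · rintro ⟨⟨i, l⟩, ⟨j, k⟩⟩ h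
          simp only [Finset.mem_sigma, Finset.HasAntidiagonal.mem_antidiagonal] at h
          obtain ⟨h1, h2⟩ := h
          subst h2
          rfl
        · rintro ⟨⟨i, l⟩, ⟨j, k⟩⟩ h
          rfl
    _ = ∑ jr ∈ Finset.HasAntidiagonal.antidiagonal n, (-1) ^ jr.1 * Y jr.1 * Ring.multichoose μ jr.1 *
          Ring.multichoose (μ + ν + jr.1) jr.2 := by
        refine Finset.sum_congr rfl fun jr _ => ?_
        rw [← Finset.mul_sum, multichoose_add]
        ring_nf
    -- The moment relation `hY` removes `(μ)_j`. Then `(μ + ν)_j (μ + ν + j)_k = (μ + ν)_n` leaves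
    -- the sum, and the same splitting for `μ + 1/2` prepares the second Vandermonde summation.
    _ = ∑ jr ∈ Finset.HasAntidiagonal.antidiagonal n, Y 0 * (ascPochhammer ℝ n).eval (μ + ν) *
          ((ascPochhammer ℝ n).eval (μ + 1 / 2))⁻¹ * ((-1) ^ jr.1 * Ring.multichoose (μ - ν) jr.1 *
            Ring.multichoose (μ + 1 / 2 + jr.1) jr.2) := by
        refine Finset.sum_congr rfl fun jr hjr => ?_
        rw [Finset.HasAntidiagonal.mem_antidiagonal] at hjr
        have h1 := hY jr.1
        have h2 := ascPochhammer_eval_add (μ + ν) jr.1 jr.2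
        have h3 := ascPochhammer_eval_add (μ + 1 / 2) jr.1 jr.2
        have h4 := hc (jr.1 + jr.2)
        have h5 : (ascPochhammer ℝ jr.2).eval (μ + 1 / 2 + jr.1) ≠ 0 :=
          (ascPochhammer_pos _ _ (by positivity)).ne'
        have h6 : Y jr.1 * (ascPochhammer ℝ jr.1).eval μ =
          Y 0 * (ascPochhammer ℝ jr.1).eval (μ + ν) * (ascPochhammer ℝ jr.1).eval (μ - ν) /
            (ascPochhammer ℝ jr.1).eval (μ + 1 / 2) := by
          rw [← h1, mul_div_cancel_right₀ _ (hc _)]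
        rw [← hjr, h2, h3]
        simp only [multichoose_eq_div]
        rw [show ∀ u v w x y z : ℝ, u * v * (w / x) * (y / z) = u * (v * w) / x * (y / z) by
          intros; ring, h6]
        have h7 := hc jr.1
        have h8 := hf jr.1
        have h9 := hf jr.2
        generalize μ + 1 / 2 = C at *
        field_simp
    _ = _ := by
        rw [← Finset.mul_sum, sum_multichoose_mul_multichoose_add, multichoose_eq_div]
        rw [show μ + 1 / 2 - (μ - ν) = ν + 1 / 2 by ring]
        field_simp

/-! ### Binomial series, Gamma quotients and duplication -/

theorem hasSum_multichoose_mul_pow (a : ℝ) {x : ℝ} (hx : |x| < 1) :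
    HasSum (fun n => Ring.multichoose a n * x ^ n) ((1 - x) ^ (-a)) := by
  have h := (Real.one_div_one_sub_rpow_hasFPowerSeriesOnBall_zero a).hasSum (y := x)
    (by simpa [enorm_eq_nnnorm, ← NNReal.coe_lt_one] using hx)
  simp only [FormalMultilinearSeries.ofScalars_apply_eq, zero_add, smul_eq_mul] at h
  rw [Real.rpow_neg (by linarith [abs_lt.1 hx]), ← one_div]
  simpa only [Ring.multichoose_eq] using h

theorem summable_abs_multichoose_mul_pow (a : ℝ) {x : ℝ} (hx : |x| < 1) :
    Summable (fun n => ‖Ring.multichoose a n * x ^ n‖) :=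
  (hasSum_multichoose_mul_pow a hx).summable.norm

theorem Gamma_add_natCast {a : ℝ} (ha : 0 < a) (n : ℕ) :
    Real.Gamma (a + n) = Real.Gamma a * (ascPochhammer ℝ n).eval a := by
  induction n with
  | zero => simp
  | succ n ih =>
    rw [ascPochhammer_succ_eval, Nat.cast_succ, ← add_assoc, Real.Gamma_add_one (by positivity), ih]
    ring

theorem ascPochhammer_two_mul_eval (μ : ℝ) (n : ℕ) :
    (ascPochhammer ℝ (2 * n)).eval (2 * μ) =
      4 ^ n * (ascPochhammer ℝ n).eval μ * (ascPochhammer ℝ n).eval (μ + 1 / 2) := by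
  induction n with
  | zero => simp
  | succ n ih =>
    rw [show 2 * (n + 1) = 2 * n + 1 + 1 by ring, ascPochhammer_succ_eval, ascPochhammer_succ_eval,
      ih, ascPochhammer_succ_eval, ascPochhammer_succ_eval]
    push_cast
    ring

/-! ### Gamma-kernel mixtures and the Beta integral -/

theorem integrableOn_rpow_mul_exp_neg_mul_Ioi {a r : ℝ} (ha : 0 < a) (hr : 0 < r) :
    IntegrableOn (fun t : ℝ => t ^ (a - 1) * Real.exp (-(r * t))) (Set.Ioi 0) := by
  have := integrableOn_rpow_mul_exp_neg_mul_rpow (p := 1) (s := a - 1) (b := r)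
    (by linarith) one_pos hr
  simpa using this

/-- Integrability of a mixture of Gamma kernels. -/
theorem integrable_prod_gammaKernel {μ : ℝ} (hμ : 0 < μ) {g φ : ℝ → ℝ} (hg : Measurable g)
    (hφ : Measurable φ) (hφ0 : ∀ t, 0 < t → 0 < φ t)
    (hint : IntegrableOn (fun t => g t * φ t ^ (-μ)) (Set.Ioi 0)) :
    Integrable (fun zt : ℝ × ℝ => zt.1 ^ (μ - 1) * Real.exp (-(φ zt.2 * zt.1)) * g zt.2)
      ((volume.restrict (Set.Ioi 0)).prod (volume.restrict (Set.Ioi 0))) := by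
  rw [integrable_prod_iff' (by fun_prop)]
  refine ⟨?_, ?_⟩
  · filter_upwards [ae_restrict_mem measurableSet_Ioi] with t ht
    exact (integrableOn_rpow_mul_exp_neg_mul_Ioi hμ (hφ0 t ht)).mul_const _
  · refine (hint.norm.const_mul (Real.Gamma μ)).congr ?_
    filter_upwards [ae_restrict_mem measurableSet_Ioi] with t ht
    have ht := hφ0 t ht
    have : ∫ z in Set.Ioi (0 : ℝ), ‖z ^ (μ - 1) * Real.exp (-(φ t * z)) * g t‖ =
        ∫ z in Set.Ioi (0 : ℝ), z ^ (μ - 1) * Real.exp (-(φ t * z)) * ‖g t‖ := by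
      refine setIntegral_congr_fun measurableSet_Ioi fun z hz => ?_
      have hz : 0 < z := hz
      rw [norm_mul, Real.norm_of_nonneg (by positivity)]
    rw [this, integral_mul_const, Real.integral_rpow_mul_exp_neg_mul_Ioi hμ ht, norm_mul,
      Real.norm_of_nonneg (Real.rpow_nonneg ht.le _), one_div, Real.inv_rpow ht.le,
      Real.rpow_neg ht.le]
    ring

theorem integral_integral_gammaKernel {μ : ℝ} (hμ : 0 < μ) {g φ : ℝ → ℝ} (hg : Measurable g)
    (hφ : Measurable φ) (hφ0 : ∀ t, 0 < t → 0 < φ t)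
    (hint : IntegrableOn (fun t => g t * φ t ^ (-μ)) (Set.Ioi 0)) :
    ∫ z in Set.Ioi (0 : ℝ), ∫ t in Set.Ioi (0 : ℝ),
        z ^ (μ - 1) * Real.exp (-(φ t * z)) * g t =
      Real.Gamma μ * ∫ t in Set.Ioi (0 : ℝ), g t * φ t ^ (-μ) := by
  rw [integral_integral_swap (integrable_prod_gammaKernel hμ hg hφ hφ0 hint), ← integral_const_mul]
  refine setIntegral_congr_fun measurableSet_Ioi fun t ht => ?_
  have ht := hφ0 t ht
  rw [integral_mul_const, Real.integral_rpow_mul_exp_neg_mul_Ioi hμ ht, one_div,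
    Real.inv_rpow ht.le, Real.rpow_neg ht.le]
  ring

/-- Integrate `s ^ (p + q - 1) * exp (-(1 + t) s) * t ^ (p - 1)` over the quadrant in both orders:
one gives `Γ(p) Γ(q)`, the other `Γ(p + q)` times the Beta integral. The same Fubini argument yields
integrability. -/
theorem integrableOn_beta_Ioi {p q : ℝ} (hp : 0 < p) (hq : 0 < q) :
    IntegrableOn (fun t : ℝ => t ^ (p - 1) * (1 + t) ^ (-(p + q))) (Set.Ioi 0) ∧
    ∫ t in Set.Ioi (0 : ℝ), t ^ (p - 1) * (1 + t) ^ (-(p + q)) =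
      Real.Gamma p * Real.Gamma q / Real.Gamma (p + q) := by
  have hpq := Real.Gamma_pos_of_pos (add_pos hp hq)
  have inner : ∀ s : ℝ, 0 < s → ∫ t in Set.Ioi (0 : ℝ),
      s ^ (p + q - 1) * Real.exp (-((1 + t) * s)) * t ^ (p - 1) =
      Real.Gamma p * (s ^ (q - 1) * Real.exp (-(1 * s))) := by
    intro s hs
    calc _ = ∫ t in Set.Ioi (0 : ℝ), s ^ (p + q - 1) * Real.exp (-s) *
          (t ^ (p - 1) * Real.exp (-(s * t))) := by
          congr 1; funext t
          rw [show -((1 + t) * s) = -s + -(s * t) by ring, Real.exp_add]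
          ring
      _ = _ := by
          rw [integral_const_mul, Real.integral_rpow_mul_exp_neg_mul_Ioi hp hs, one_div,
            Real.inv_rpow hs.le, ← Real.rpow_neg hs.le,
            show q - 1 = (p + q - 1) + -p by ring, Real.rpow_add hs]
          ring_nf
  have hprod : Integrable
      (fun st : ℝ × ℝ => st.1 ^ (p + q - 1) * Real.exp (-((1 + st.2) * st.1)) * st.2 ^ (p - 1))
      ((volume.restrict (Set.Ioi 0)).prod (volume.restrict (Set.Ioi 0))) := by
    rw [integrable_prod_iff (by fun_prop)]
    refine ⟨?_, ?_⟩
    · filter_upwards [ae_restrict_mem measurableSet_Ioi] with s hs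
      refine ((integrableOn_rpow_mul_exp_neg_mul_Ioi hp hs).const_mul
        (s ^ (p + q - 1) * Real.exp (-s))).congr (ae_of_all _ fun t => ?_)
      simp only
      rw [show -((1 + t) * s) = -s + -(s * t) by ring, Real.exp_add]
      ring
    · refine ((integrableOn_rpow_mul_exp_neg_mul_Ioi hq one_pos).const_mul (Real.Gamma p)).congr ?_
      filter_upwards [ae_restrict_mem measurableSet_Ioi] with s hs
      rw [← inner s hs]
      refine setIntegral_congr_fun measurableSet_Ioi fun t ht => ?_
      have ht : 0 < t := ht
      have hs : 0 < s := hs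
      rw [Real.norm_of_nonneg (by positivity)]
  have inner' : ∀ t : ℝ, 0 < t → ∫ s in Set.Ioi (0 : ℝ),
      s ^ (p + q - 1) * Real.exp (-((1 + t) * s)) * t ^ (p - 1) =
      Real.Gamma (p + q) * (t ^ (p - 1) * (1 + t) ^ (-(p + q))) := by
    intro t ht
    have ht1 : 0 < 1 + t := by linarith
    rw [integral_mul_const, Real.integral_rpow_mul_exp_neg_mul_Ioi (by positivity) ht1, one_div,
      Real.inv_rpow ht1.le, ← Real.rpow_neg ht1.le]
    ring
  refine ⟨?_, ?_⟩
  · refine (hprod.integral_prod_right.const_mul (Real.Gamma (p + q))⁻¹).congr ?_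
    filter_upwards [ae_restrict_mem measurableSet_Ioi] with t ht
    rw [inner' t ht, inv_mul_cancel_left₀ hpq.ne']
  · rw [eq_div_iff hpq.ne', mul_comm, ← integral_const_mul,
      ← setIntegral_congr_fun measurableSet_Ioi inner', ← integral_integral_swap hprod,
      setIntegral_congr_fun measurableSet_Ioi inner, integral_const_mul]
    have := Real.integral_rpow_mul_exp_neg_mul_Ioi hq one_pos
    rw [this]
    simp

/-! ### Moments of the Beta weight -/

/-- The weight of the Beta distribution of the second kind. -/
noncomputable def betaWeight (μ ν t : ℝ) : ℝ :=
  t ^ (μ + ν - 1) * (1 + t) ^ (-(2 * μ))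

theorem measurable_betaWeight (μ ν : ℝ) : Measurable (betaWeight μ ν) := by
  unfold betaWeight; fun_prop

theorem betaWeight_pos (μ ν : ℝ) {t : ℝ} (ht : 0 < t) : 0 < betaWeight μ ν t := by
  unfold betaWeight; positivity

theorem betaWeight_mul_pow (μ ν : ℝ) {t : ℝ} (ht : 0 < t) (j : ℕ) :
    betaWeight μ ν t * (4 * t / (1 + t) ^ 2) ^ j =
      4 ^ j * (t ^ ((μ + ν + j) - 1) * (1 + t) ^ (-((μ + ν + j) + (μ - ν + j)))) := by
  have ht1 : 0 < 1 + t := by linarith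
  unfold betaWeight
  rw [show (μ + ν + j) - 1 = (μ + ν - 1) + j by ring,
    show -((μ + ν + j) + (μ - ν + j)) = -(2 * μ) + -((2 * j : ℕ) : ℝ) by push_cast; ring,
    Real.rpow_add ht, Real.rpow_add ht1, Real.rpow_natCast, Real.rpow_neg ht1.le (2 * j : ℕ),
    Real.rpow_natCast, div_pow, mul_pow, ← pow_mul]
  ring

theorem integrableOn_betaWeight_mul_pow {μ ν : ℝ} (hp : 0 < μ + ν) (hq : 0 < μ - ν) (j : ℕ) :
    IntegrableOn (fun t => betaWeight μ ν t * (4 * t / (1 + t) ^ 2) ^ j) (Set.Ioi 0) := by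
  have h := (integrableOn_beta_Ioi (p := μ + ν + j) (q := μ - ν + j) (by positivity)
    (by positivity)).1
  refine (h.const_mul (4 ^ j)).congr ?_
  filter_upwards [ae_restrict_mem measurableSet_Ioi] with t ht
  exact (betaWeight_mul_pow μ ν ht j).symm

theorem integral_betaWeight_mul_pow {μ ν : ℝ} (hp : 0 < μ + ν) (hq : 0 < μ - ν) (j : ℕ) :
    ∫ t in Set.Ioi (0 : ℝ), betaWeight μ ν t * (4 * t / (1 + t) ^ 2) ^ j =
      4 ^ j * (Real.Gamma (μ + ν + j) * Real.Gamma (μ - ν + j) / Real.Gamma (2 * μ + 2 * j)) := by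
  have h := (integrableOn_beta_Ioi (p := μ + ν + j) (q := μ - ν + j) (by positivity)
    (by positivity)).2
  rw [setIntegral_congr_fun measurableSet_Ioi fun t ht => betaWeight_mul_pow μ ν ht j,
    integral_const_mul, h]
  ring_nf

/-- Duplication writes `(2μ)_{2j}` as `4 ^ j (μ)_j (μ + 1/2)_j`, and the `4 ^ j` cancels that of the
moment. This is hypothesis `hY` of `sum_antidiagonal_hypergeometric`. -/
theorem integral_betaWeight_mul_pow_rec {μ ν : ℝ} (hp : 0 < μ + ν) (hq : 0 < μ - ν) (j : ℕ) :
    (∫ t in Set.Ioi (0 : ℝ), betaWeight μ ν t * (4 * t / (1 + t) ^ 2) ^ j) *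
        (ascPochhammer ℝ j).eval μ * (ascPochhammer ℝ j).eval (μ + 1 / 2) =
      (∫ t in Set.Ioi (0 : ℝ), betaWeight μ ν t * (4 * t / (1 + t) ^ 2) ^ 0) *
        (ascPochhammer ℝ j).eval (μ + ν) * (ascPochhammer ℝ j).eval (μ - ν) := by
  have hμ : 0 < μ := by linarith
  have h2 := Gamma_add_natCast (a := 2 * μ) (by positivity) (2 * j)
  rw [ascPochhammer_two_mul_eval] at h2
  push_cast at h2
  rw [integral_betaWeight_mul_pow hp hq, integral_betaWeight_mul_pow hp hq, h2,
    Gamma_add_natCast hp, Gamma_add_natCast hq]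
  have hG : Real.Gamma (2 * μ) ≠ 0 := (Real.Gamma_pos_of_pos (by positivity)).ne'
  have hm : (ascPochhammer ℝ j).eval μ ≠ 0 := (ascPochhammer_pos j _ hμ).ne'
  have hc : (ascPochhammer ℝ j).eval (μ + 1 / 2) ≠ 0 := (ascPochhammer_pos j _ (by positivity)).ne'
  generalize (ascPochhammer ℝ j).eval (μ + 1 / 2) = C at *
  simp
  field_simp

/-! ### Termwise integration and the Gauss series -/

theorem betaArg_mem {t : ℝ} (ht : 0 < t) :
    0 < 4 * t / (1 + t) ^ 2 ∧ 4 * t / (1 + t) ^ 2 ≤ 1 := by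
  refine ⟨by positivity, ?_⟩
  rw [div_le_one (by positivity)]
  nlinarith [sq_nonneg (1 - t)]

theorem one_sub_pow_eq_sum (y : ℝ) (l : ℕ) :
    (1 - y) ^ l = ∑ jk ∈ Finset.HasAntidiagonal.antidiagonal l,
      (-1) ^ jk.1 * (l.choose jk.1 : ℝ) * y ^ jk.1 := by
  rw [sub_eq_add_neg, add_comm, (Commute.all _ _).add_pow']
  refine Finset.sum_congr rfl fun jk _ => ?_
  rw [one_pow, mul_one, nsmul_eq_mul, neg_pow]
  ring

/-- Coefficients of the expansion of `(1 - x) ^ (-ν) * (1 - x * (1 - y)) ^ (-μ)` in powers of `x`. -/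
noncomputable def binomialProdCoeff (μ ν : ℝ) (n : ℕ) (y : ℝ) : ℝ :=
  ∑ il ∈ Finset.HasAntidiagonal.antidiagonal n,
    Ring.multichoose ν il.1 * (Ring.multichoose μ il.2 * (1 - y) ^ il.2)

theorem binomialProdCoeff_mul_pow (μ ν : ℝ) (n : ℕ) (x y : ℝ) :
    binomialProdCoeff μ ν n y * x ^ n = ∑ il ∈ Finset.HasAntidiagonal.antidiagonal n,
      (Ring.multichoose ν il.1 * x ^ il.1) * (Ring.multichoose μ il.2 * (x * (1 - y)) ^ il.2) := by
  rw [binomialProdCoeff, Finset.sum_mul]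
  refine Finset.sum_congr rfl fun il hil => ?_
  rw [Finset.HasAntidiagonal.mem_antidiagonal] at hil
  rw [← hil, pow_add, mul_pow]
  ring

/-- A majorant free of `y`, summable for `|x| < 1`, which justifies integrating the series termwise.
Expanding in powers of `y x / (1 - x)` instead would fail to converge for `x` near 1. -/
theorem abs_binomialProdCoeff_mul_pow_le (μ ν : ℝ) (n : ℕ) {x y : ℝ} (hy : |1 - y| ≤ 1) :
    |binomialProdCoeff μ ν n y * x ^ n| ≤ ∑ il ∈ Finset.HasAntidiagonal.antidiagonal n,
      ‖Ring.multichoose ν il.1 * x ^ il.1‖ * ‖Ring.multichoose μ il.2 * x ^ il.2‖ := by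
  rw [binomialProdCoeff_mul_pow]
  refine (Finset.abs_sum_le_sum_abs _ _).trans (Finset.sum_le_sum fun il _ => ?_)
  rw [abs_mul, Real.norm_eq_abs, Real.norm_eq_abs]
  refine mul_le_mul_of_nonneg_left ?_ (abs_nonneg _)
  rw [mul_pow, ← mul_assoc, abs_mul]
  refine mul_le_of_le_one_right (abs_nonneg _) ?_
  rw [abs_pow]
  exact pow_le_one₀ (abs_nonneg _) hy

theorem summable_binomialProd_bound (μ ν : ℝ) {x : ℝ} (hx : |x| < 1) :
    Summable fun n => ∑ il ∈ Finset.HasAntidiagonal.antidiagonal n,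
      ‖Ring.multichoose ν il.1 * x ^ il.1‖ * ‖Ring.multichoose μ il.2 * x ^ il.2‖ := by
  have := summable_norm_sum_mul_antidiagonal_of_summable_norm
    (f := fun n => ‖Ring.multichoose ν n * x ^ n‖) (g := fun n => ‖Ring.multichoose μ n * x ^ n‖)
    (by simpa only [norm_norm] using summable_abs_multichoose_mul_pow ν hx)
    (by simpa only [norm_norm] using summable_abs_multichoose_mul_pow μ hx)
  refine this.congr fun n => ?_
  exact Real.norm_of_nonneg (Finset.sum_nonneg fun il _ => by positivity)

theorem tsum_binomialProdCoeff_mul_pow (μ ν : ℝ) {x y : ℝ} (hx : |x| < 1) (hy : |1 - y| ≤ 1) :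
    ∑' n, binomialProdCoeff μ ν n y * x ^ n = (1 - x) ^ (-ν) * (1 - x * (1 - y)) ^ (-μ) := by
  have hxy : |x * (1 - y)| < 1 := by
    rw [abs_mul]
    exact (mul_le_of_le_one_right (abs_nonneg _) hy).trans_lt hx
  rw [← (hasSum_multichoose_mul_pow ν hx).tsum_eq, ← (hasSum_multichoose_mul_pow μ hxy).tsum_eq,
    tsum_mul_tsum_eq_tsum_sum_antidiagonal_of_summable_norm (summable_abs_multichoose_mul_pow ν hx)
      (summable_abs_multichoose_mul_pow μ hxy)]
  exact tsum_congr fun n => binomialProdCoeff_mul_pow μ ν n x y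

theorem measurable_binomialProdCoeff (μ ν : ℝ) (n : ℕ) : Measurable (binomialProdCoeff μ ν n) := by
  unfold binomialProdCoeff; fun_prop

theorem integral_betaWeight_mul_coeff {μ ν : ℝ} (hp : 0 < μ + ν) (hq : 0 < μ - ν) (n : ℕ) :
    ∫ t in Set.Ioi (0 : ℝ), betaWeight μ ν t * binomialProdCoeff μ ν n (4 * t / (1 + t) ^ 2) =
      Real.Gamma (μ + ν) * Real.Gamma (μ - ν) / Real.Gamma (2 * μ) *
        ((n.factorial : ℝ)⁻¹ * (ascPochhammer ℝ n).eval (μ + ν) *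
        (ascPochhammer ℝ n).eval (ν + 1 / 2) * ((ascPochhammer ℝ n).eval (μ + 1 / 2))⁻¹) := by
  have h := sum_antidiagonal_hypergeometric μ ν (by linarith) _
    (integral_betaWeight_mul_pow_rec hp hq) n
  have h0 := integral_betaWeight_mul_pow hp hq 0
  simp only [pow_zero, Nat.cast_zero, add_zero, mul_zero, one_mul] at h0
  rw [← h0]
  simp only [pow_zero] at h
  rw [← h]
  have hint := integrableOn_betaWeight_mul_pow hp hq
  have expand : ∀ t, betaWeight μ ν t * binomialProdCoeff μ ν n (4 * t / (1 + t) ^ 2) =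
      ∑ il ∈ Finset.HasAntidiagonal.antidiagonal n,
        ∑ jk ∈ Finset.HasAntidiagonal.antidiagonal il.2,
        Ring.multichoose ν il.1 * Ring.multichoose μ il.2 * ((-1) ^ jk.1 * (il.2.choose jk.1 : ℝ)) *
          (betaWeight μ ν t * (4 * t / (1 + t) ^ 2) ^ jk.1) := by
    intro t
    rw [binomialProdCoeff, Finset.mul_sum]
    refine Finset.sum_congr rfl fun il _ => ?_
    rw [one_sub_pow_eq_sum, Finset.mul_sum, Finset.mul_sum, Finset.mul_sum]
    refine Finset.sum_congr rfl fun jk _ => ?_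
    ring
  simp_rw [expand]
  rw [integral_finsetSum _ fun il _ => integrable_finsetSum _ fun jk _ => (hint jk.1).const_mul _]
  refine Finset.sum_congr rfl fun il _ => ?_
  rw [integral_finsetSum _ fun jk _ => (hint jk.1).const_mul _, Finset.mul_sum, Finset.mul_sum]
  refine Finset.sum_congr rfl fun jk _ => ?_
  rw [integral_const_mul]
  ring

/-- An integral representation of the Gauss hypergeometric function. -/
theorem integral_betaWeight_eq_hypergeometric {μ ν x : ℝ} (hp : 0 < μ + ν) (hq : 0 < μ - ν)
    (hx : |x| < 1) :
    (1 - x) ^ (-ν) * ∫ t in Set.Ioi (0 : ℝ),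
        betaWeight μ ν t * (1 - x * (1 - 4 * t / (1 + t) ^ 2)) ^ (-μ) =
      Real.Gamma (μ + ν) * Real.Gamma (μ - ν) / Real.Gamma (2 * μ) *
        ordinaryHypergeometric (𝕂 := ℝ) (μ + ν) (ν + 1 / 2) (μ + 1 / 2) x := by
  have hy : ∀ t : ℝ, 0 < t → |1 - 4 * t / (1 + t) ^ 2| ≤ 1 := by
    intro t ht
    obtain ⟨h1, h2⟩ := betaArg_mem ht
    rw [abs_le]; constructor <;> linarith
  have hint0 : IntegrableOn (betaWeight μ ν) (Set.Ioi 0) := by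
    simpa using integrableOn_betaWeight_mul_pow hp hq 0
  set B : ℕ → ℝ := fun n => ∑ il ∈ Finset.HasAntidiagonal.antidiagonal n,
      ‖Ring.multichoose ν il.1 * x ^ il.1‖ * ‖Ring.multichoose μ il.2 * x ^ il.2‖ with hB
  set F : ℕ → ℝ → ℝ := fun n t =>
    betaWeight μ ν t * (binomialProdCoeff μ ν n (4 * t / (1 + t) ^ 2) * x ^ n) with hF
  have hFle : ∀ n t, 0 < t → ‖F n t‖ ≤ B n * betaWeight μ ν t := by
    intro n t ht
    rw [hF, norm_mul, Real.norm_of_nonneg (betaWeight_pos μ ν ht).le, mul_comm]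
    exact mul_le_mul_of_nonneg_right (abs_binomialProdCoeff_mul_pow_le μ ν n (hy t ht))
      (betaWeight_pos μ ν ht).le
  have hFint : ∀ n, IntegrableOn (F n) (Set.Ioi 0) := by
    intro n
    refine (hint0.const_mul (B n)).mono' ?_ ?_
    · have h1 := measurable_betaWeight μ ν
      have h2 := measurable_binomialProdCoeff μ ν n
      exact (h1.mul ((h2.comp (by fun_prop)).mul_const _)).aestronglyMeasurable
    · filter_upwards [ae_restrict_mem measurableSet_Ioi] with t ht using hFle n t ht
  have hsum : Summable fun n => ∫ t in Set.Ioi (0 : ℝ), ‖F n t‖ := by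
    refine Summable.of_nonneg_of_le (fun n => integral_nonneg fun t => norm_nonneg _) (fun n => ?_)
      ((summable_binomialProd_bound μ ν hx).mul_right
        (∫ t in Set.Ioi (0 : ℝ), betaWeight μ ν t))
    rw [← integral_const_mul]
    exact setIntegral_mono_on (hFint n).norm (hint0.const_mul _) measurableSet_Ioi
      fun t ht => hFle n t ht
  have key := (hasSum_integral_of_summable_integral_norm hFint hsum).tsum_eq
  have hF1 : ∀ n, ∫ t in Set.Ioi (0 : ℝ), F n t =
      Real.Gamma (μ + ν) * Real.Gamma (μ - ν) / Real.Gamma (2 * μ) *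
        (((n.factorial : ℝ)⁻¹ * (ascPochhammer ℝ n).eval (μ + ν) *
        (ascPochhammer ℝ n).eval (ν + 1 / 2) * ((ascPochhammer ℝ n).eval (μ + 1 / 2))⁻¹) *
          x ^ n) := by
    intro n
    rw [← mul_assoc, ← integral_betaWeight_mul_coeff hp hq, ← integral_mul_const]
    simp only [hF, mul_assoc]
  rw [tsum_congr hF1, tsum_mul_left] at key
  rw [ordinaryHypergeometric_eq_tsum]
  simp only [smul_eq_mul]
  rw [key, ← integral_const_mul]
  refine setIntegral_congr_fun measurableSet_Ioi fun t ht => ?_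
  simp only [hF]
  rw [tsum_mul_left, tsum_binomialProdCoeff_mul_pow μ ν hx (hy t ht)]
  ring

/-! ### Reduction of the Mellin-type integral to the Beta weight -/

/-- The left side is `α + σ (τ + 1 / τ) = (α - 2σ) + σ (1 + τ) ^ 2 / τ`; factor out `(1 + τ) ^ 2 /
τ`. -/
theorem add_rescaled_eq {α κ σ a b τ : ℝ} (hσ : 0 < σ) (hα : 2 * σ < α) (hτ : 0 < τ) (hκ : 0 < κ)
    (hb : b * κ = σ) (ha : a = σ * κ) :
    α + b * (κ * τ) + a / (κ * τ) =
      (α + 2 * σ) / 4 * ((1 + τ) ^ 2 / τ) *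
        (1 - (α - 2 * σ) / (α + 2 * σ) * (1 - 4 * τ / (1 + τ) ^ 2)) := by
  have h1 : α + 2 * σ ≠ 0 := by linarith
  have h2 : (1 + τ) ≠ 0 := by linarith
  obtain ⟨D, rfl⟩ : ∃ D, α = D - 2 * σ := ⟨α + 2 * σ, by ring⟩
  rw [sub_add_cancel] at h1 ⊢
  rw [ha, ← mul_assoc, hb]
  field_simp
  ring

theorem rescaled_integrand_eq {α κ σ a b τ μ ν : ℝ} (hσ : 0 < σ) (hα : 2 * σ < α) (hτ : 0 < τ)
    (hκ : 0 < κ) (hb : b * κ = σ) (ha : a = σ * κ) :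
    (κ * τ) ^ (ν - 1) * (α + b * (κ * τ) + a / (κ * τ)) ^ (-μ) =
      κ ^ (ν - 1) * ((α + 2 * σ) / 4) ^ (-μ) * (betaWeight μ ν τ *
        (1 - (α - 2 * σ) / (α + 2 * σ) * (1 - 4 * τ / (1 + τ) ^ 2)) ^ (-μ)) := by
  obtain ⟨hy0, hy1⟩ := betaArg_mem hτ
  have hx0 : 0 < (α - 2 * σ) / (α + 2 * σ) := div_pos (by linarith) (by linarith)
  have hx1 : (α - 2 * σ) / (α + 2 * σ) < 1 := by rw [div_lt_one] <;> linarith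
  have hpos : 0 ≤ 1 - (α - 2 * σ) / (α + 2 * σ) * (1 - 4 * τ / (1 + τ) ^ 2) := by
    nlinarith
  have h1τ : 0 < 1 + τ := by linarith
  have hs : 0 ≤ (α + 2 * σ) / 4 := by linarith
  rw [add_rescaled_eq hσ hα hτ hκ hb ha, Real.mul_rpow (by positivity) hpos,
    Real.mul_rpow hs (by positivity), Real.mul_rpow hκ.le hτ.le, Real.div_rpow (by positivity) hτ.le,
    ← Real.rpow_natCast_mul h1τ.le, betaWeight, show μ + ν - 1 = (ν - 1) - -μ by ring,
    Real.rpow_sub hτ (ν - 1) (-μ)]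
  push_cast
  rw [show (2 : ℝ) * -μ = -(2 * μ) by ring]
  ring

/-- The Mellin-type integral behind `∫ z ^ (μ - 1) e ^ (-α z) K_ν (β z) dz`, in terms of the Gauss
hypergeometric function. -/
theorem integral_rpow_mul_add_rpow {a b α μ ν : ℝ} (ha : 0 < a) (hb : 0 < b)
    (hα : 2 * √(a * b) < α) (hp : 0 < μ + ν) (hq : 0 < μ - ν) :
    IntegrableOn (fun t : ℝ => t ^ (ν - 1) * (α + b * t + a / t) ^ (-μ)) (Set.Ioi 0) ∧
    Real.Gamma μ * ∫ t in Set.Ioi (0 : ℝ), t ^ (ν - 1) * (α + b * t + a / t) ^ (-μ) =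
      2 * √Real.pi * 4 ^ ν * a ^ ν * Real.Gamma (μ + ν) * Real.Gamma (μ - ν) /
        ((α + 2 * √(a * b)) ^ (μ + ν) * Real.Gamma (μ + 1 / 2)) *
      ordinaryHypergeometric (𝕂 := ℝ) (μ + ν) (ν + 1 / 2) (μ + 1 / 2)
        ((α - 2 * √(a * b)) / (α + 2 * √(a * b))) := by
  have hμ : 0 < μ := by linarith
  have hσ : 0 < √(a * b) := Real.sqrt_pos.2 (by positivity)
  -- The scale `κ = √a / √b` balances the two terms: `b κ` and `a / κ` both equal `σ = √(a b)`.
  have hκ : 0 < √a / √b := div_pos (Real.sqrt_pos.2 ha) (Real.sqrt_pos.2 hb)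
  have hbκ : b * (√a / √b) = √(a * b) := by
    rw [Real.sqrt_mul ha.le]
    have := Real.sqrt_pos.2 hb
    field_simp
    rw [Real.sq_sqrt hb.le]
  have haκ : a = √(a * b) * (√a / √b) := by
    rw [Real.sqrt_mul ha.le]
    have := Real.sqrt_pos.2 hb
    field_simp
    rw [Real.sq_sqrt ha.le]
  generalize √(a * b) = σ at *
  generalize √a / √b = κ at *
  have hD : 0 < α + 2 * σ := by linarith
  have hx0 : 0 < (α - 2 * σ) / (α + 2 * σ) := div_pos (by linarith) hD
  have hx1 : (α - 2 * σ) / (α + 2 * σ) < 1 := by rw [div_lt_one] <;> linarith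
  have hx : |(α - 2 * σ) / (α + 2 * σ)| < 1 := by rwa [abs_of_pos hx0]
  have h1x : 1 - (α - 2 * σ) / (α + 2 * σ) = 4 * σ / (α + 2 * σ) := by field_simp; ring
  have h1x0 : 0 < 1 - (α - 2 * σ) / (α + 2 * σ) := by linarith
  have key := integral_betaWeight_eq_hypergeometric hp hq hx
  have hres : ∀ τ : ℝ, 0 < τ → (κ * τ) ^ (ν - 1) * (α + b * (κ * τ) + a / (κ * τ)) ^ (-μ) =
      κ ^ (ν - 1) * ((α + 2 * σ) / 4) ^ (-μ) * (betaWeight μ ν τ *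
        (1 - (α - 2 * σ) / (α + 2 * σ) * (1 - 4 * τ / (1 + τ) ^ 2)) ^ (-μ)) := fun τ hτ =>
    rescaled_integrand_eq hσ hα hτ hκ hbκ haκ
  refine ⟨?_, ?_⟩
  · have h0 : IntegrableOn (betaWeight μ ν) (Set.Ioi 0) := by
      simpa using integrableOn_betaWeight_mul_pow hp hq 0
    have h1 : IntegrableOn (fun τ => betaWeight μ ν τ *
        (1 - (α - 2 * σ) / (α + 2 * σ) * (1 - 4 * τ / (1 + τ) ^ 2)) ^ (-μ)) (Set.Ioi 0) := by
      refine (h0.mul_const ((1 - (α - 2 * σ) / (α + 2 * σ)) ^ (-μ))).mono' ?_ ?_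
      · exact ((measurable_betaWeight μ ν).mul (by fun_prop)).aestronglyMeasurable
      · filter_upwards [ae_restrict_mem measurableSet_Ioi] with τ hτ
        have hτ : 0 < τ := hτ
        obtain ⟨hy0, hy1⟩ := betaArg_mem hτ
        have hle : 1 - (α - 2 * σ) / (α + 2 * σ) ≤
            1 - (α - 2 * σ) / (α + 2 * σ) * (1 - 4 * τ / (1 + τ) ^ 2) := by nlinarith
        rw [Real.norm_of_nonneg (mul_nonneg (betaWeight_pos μ ν hτ).le
          (Real.rpow_nonneg (h1x0.le.trans hle) _))]
        exact mul_le_mul_of_nonneg_left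
          (Real.rpow_le_rpow_of_nonpos h1x0 hle (by linarith)) (betaWeight_pos μ ν hτ).le
    rw [← mul_zero κ, ← integrableOn_Ioi_comp_mul_left_iff _ _ hκ]
    refine (h1.const_mul (κ ^ (ν - 1) * ((α + 2 * σ) / 4) ^ (-μ))).congr ?_
    filter_upwards [ae_restrict_mem measurableSet_Ioi] with τ hτ using (hres τ hτ).symm
  · have h2 := integral_comp_mul_left_Ioi
      (fun t : ℝ => t ^ (ν - 1) * (α + b * t + a / t) ^ (-μ)) 0 hκ
    rw [mul_zero, setIntegral_congr_fun measurableSet_Ioi hres, integral_const_mul, smul_eq_mul,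
      eq_inv_mul_iff_mul_eq₀ hκ.ne'] at h2
    rw [← h2]
    rw [Real.rpow_neg h1x0.le, inv_mul_eq_iff_eq_mul₀ (Real.rpow_pos_of_pos h1x0 _).ne'] at key
    rw [key]
    have hdup := Real.Gamma_mul_Gamma_add_half μ
    have hG1 : Real.Gamma (2 * μ) ≠ 0 := (Real.Gamma_pos_of_pos (by positivity)).ne'
    have hG2 : Real.Gamma (μ + 1 / 2) ≠ 0 := (Real.Gamma_pos_of_pos (by positivity)).ne'
    -- Legendre duplication is the source of `√π` and `Γ(μ + 1/2)`.
    have e1 : Real.Gamma μ / Real.Gamma (2 * μ) = 2 * 4 ^ (-μ) * √Real.pi / Real.Gamma (μ + 1 / 2) := by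
      rw [div_eq_div_iff hG1 hG2, hdup, show (1 : ℝ) - 2 * μ = 1 + 2 * -μ by ring,
        Real.rpow_add two_pos, Real.rpow_mul two_pos.le, Real.rpow_one]
      norm_num
      ring
    have e2 : κ * κ ^ (ν - 1) = κ ^ ν := by
      rw [mul_comm, ← Real.rpow_add_one hκ.ne']; ring_nf
    have e3 : κ ^ ν * (1 - (α - 2 * σ) / (α + 2 * σ)) ^ ν = 4 ^ ν * a ^ ν / (α + 2 * σ) ^ ν := by
      rw [← Real.mul_rpow hκ.le h1x0.le, h1x, ← Real.mul_rpow (by norm_num) ha.le,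
        ← Real.div_rpow (by positivity) hD.le, haκ]
      ring_nf
    have e4 : ((α + 2 * σ) / 4) ^ (-μ) * 4 ^ (-μ) = ((α + 2 * σ) ^ μ)⁻¹ := by
      rw [← Real.mul_rpow (by positivity) (by norm_num), div_mul_cancel₀ _ (by norm_num),
        Real.rpow_neg hD.le]
    rw [Real.rpow_add hD]
    generalize ordinaryHypergeometric (𝕂 := ℝ) (μ + ν) (ν + 1 / 2) (μ + 1 / 2)
        ((α - 2 * σ) / (α + 2 * σ)) = H
    calc _ = (Real.Gamma μ / Real.Gamma (2 * μ)) * ((κ * κ ^ (ν - 1)) *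
          (1 - (α - 2 * σ) / (α + 2 * σ)) ^ ν) * ((α + 2 * σ) / 4) ^ (-μ) *
          (Real.Gamma (μ + ν) * Real.Gamma (μ - ν)) * H := by ring
      _ = 2 * √Real.pi / Real.Gamma (μ + 1 / 2) * (4 ^ ν * a ^ ν / (α + 2 * σ) ^ ν) *
          (((α + 2 * σ) / 4) ^ (-μ) * 4 ^ (-μ)) *
          (Real.Gamma (μ + ν) * Real.Gamma (μ - ν)) * H := by rw [e1, e2, e3]; ring
      _ = _ := by
        rw [e4]
        have := (Real.rpow_pos_of_pos hD μ).ne'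
        have := (Real.rpow_pos_of_pos hD ν).ne'
        field_simp

/-! ### Incomplete Gamma sums and Erlang mixtures -/

/-- The incomplete Gamma integral `∫_c^∞ x ^ n e ^ (-a x) dx` as a finite sum. -/
noncomputable def expTail (a : ℝ) (n : ℕ) (c : ℝ) : ℝ :=
  ∑ r ∈ Finset.range (n + 1), (n.factorial : ℝ) * a ^ ((r : ℤ) - (n + 1)) / r.factorial *
    (c ^ r * Real.exp (-(a * c)))

theorem expTail_zero (a c : ℝ) : expTail a 0 c = a⁻¹ * Real.exp (-(a * c)) := by
  simp [expTail]

/-- The integration-by-parts recursion, on which the induction for the derivative rests. -/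
theorem expTail_succ {a : ℝ} (ha : a ≠ 0) (n : ℕ) (c : ℝ) :
    expTail a (n + 1) c = a⁻¹ * (c ^ (n + 1) * Real.exp (-(a * c)) + (n + 1) * expTail a n c) := by
  have hf : ((n + 1).factorial : ℝ) ≠ 0 := by positivity
  rw [expTail, Finset.sum_range_succ, expTail, mul_add, Finset.mul_sum, Finset.mul_sum, add_comm]
  congr 1
  · push_cast
    rw [sub_add_cancel_left, zpow_neg_one, mul_div_cancel_left₀ _ (by exact_mod_cast hf)]
  · refine Finset.sum_congr rfl fun r _ => ?_
    rw [show ((r : ℤ) - ((n + 1 : ℕ) + 1)) = ((r : ℤ) - (n + 1)) + (-1) by push_cast; ring,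
      zpow_add₀ ha, zpow_neg_one, Nat.factorial_succ]
    push_cast
    ring

theorem hasDerivAt_expTail {a : ℝ} (ha : a ≠ 0) (n : ℕ) (x : ℝ) :
    HasDerivAt (expTail a n) (-(x ^ n * Real.exp (-(a * x)))) x := by
  have hexp : HasDerivAt (fun c => Real.exp (-(a * c))) (Real.exp (-(a * x)) * -(a * 1)) x :=
    (((hasDerivAt_id x).const_mul a).neg).exp
  induction n with
  | zero =>
    have := hexp.const_mul a⁻¹
    rw [show expTail a 0 = fun c => a⁻¹ * Real.exp (-(a * c)) from funext (expTail_zero a)]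
    refine this.congr_deriv ?_
    field_simp
  | succ n ih =>
    have := (((hasDerivAt_pow (n + 1) x).mul hexp).add (ih.const_mul ((n : ℝ) + 1))).const_mul a⁻¹
    rw [show expTail a (n + 1) = fun c => a⁻¹ * (c ^ (n + 1) * Real.exp (-(a * c)) +
      (n + 1) * expTail a n c) from funext (expTail_succ ha n)]
    refine this.congr_deriv ?_
    simp
    field_simp
    ring

theorem tendsto_expTail {a : ℝ} (ha : 0 < a) (n : ℕ) :
    Filter.Tendsto (expTail a n) Filter.atTop (nhds 0) := by
  unfold expTail
  rw [show (0 : ℝ) = ∑ r ∈ Finset.range (n + 1),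
    (n.factorial : ℝ) * a ^ ((r : ℤ) - (n + 1)) / r.factorial * 0 by simp]
  refine tendsto_finsetSum _ fun r _ => Filter.Tendsto.const_mul _ ?_
  have := tendsto_rpow_mul_exp_neg_mul_atTop_nhds_zero r a ha
  simpa using this

theorem measurable_expTail (a : ℝ) (n : ℕ) : Measurable (expTail a n) := by
  unfold expTail; fun_prop

theorem integrableOn_pow_mul_exp {a : ℝ} (ha : 0 < a) (n : ℕ) {c : ℝ} (hc : 0 ≤ c) :
    IntegrableOn (fun x : ℝ => x ^ n * Real.exp (-(a * x))) (Set.Ioi c) := by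
  have := integrableOn_rpow_mul_exp_neg_mul_Ioi (a := n + 1) (r := a) (by positivity) ha
  simp only [add_sub_cancel_right, Real.rpow_natCast] at this
  exact this.mono_set (Set.Ioi_subset_Ioi hc)

theorem integral_pow_mul_exp {a : ℝ} (ha : 0 < a) (n : ℕ) {c : ℝ} (hc : 0 ≤ c) :
    ∫ x in Set.Ioi c, x ^ n * Real.exp (-(a * x)) = expTail a n c := by
  have h := integral_Ioi_of_hasDerivAt_of_tendsto
    (hasDerivAt_expTail ha.ne' n c).continuousAt.continuousWithinAt
    (fun x _ => hasDerivAt_expTail ha.ne' n x) (integrableOn_pow_mul_exp ha n hc).neg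
    (tendsto_expTail ha n)
  rw [integral_neg] at h
  linarith

namespace FSO

theorem upperGamma_natCast {d : ℕ} (hd : 1 ≤ d) {x : ℝ} (hx : 0 ≤ x) :
    upperGamma d x = ∑ k ∈ Finset.range d, ((d - 1).factorial : ℝ) / k.factorial *
      (x ^ k * Real.exp (-x)) := by
  obtain ⟨n, rfl⟩ := Nat.exists_eq_add_of_le' hd
  have := integral_pow_mul_exp one_pos n hx
  simp only [one_mul] at this
  simp only [upperGamma, Nat.cast_add, Nat.cast_one, add_sub_cancel_right, Real.rpow_natCast]
  rw [this]
  simp [expTail]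

variable {L : ℕ}

theorem Hop.rate_pos (h : Hop L) (i : Fin L) : 0 < h.rate i :=
  div_pos (h.c_pos i) (mul_pos h.A0_pos h.avgSNR_pos)

/-- The density of the SNR for integer parameters, as a mixture of Erlang kernels. -/
noncomputable def Hop.erlangPDF (h : Hop L) (n : ℕ) (d : Fin L → ℕ) (x : ℝ) : ℝ :=
  ∑ i, ∑ k ∈ Finset.range (d i), h.Xi d i k * (x ^ (n + k - 1) * Real.exp (-(h.rate i * x)))

/-- The complementary cumulative distribution function belonging to `Hop.erlangPDF`. -/
noncomputable def Hop.erlangTail (h : Hop L) (n : ℕ) (d : Fin L → ℕ) (x : ℝ) : ℝ :=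
  ∑ i, ∑ k ∈ Finset.range (d i), h.Xi d i k * expTail (h.rate i) (n + k - 1) x

theorem Hop.measurable_erlangPDF (h : Hop L) (n : ℕ) (d : Fin L → ℕ) :
    Measurable (h.erlangPDF n d) := by
  unfold erlangPDF; fun_prop

theorem Hop.measurable_erlangTail (h : Hop L) (n : ℕ) (d : Fin L → ℕ) :
    Measurable (h.erlangTail n d) :=
  Finset.measurable_fun_sum _ fun _ _ => Finset.measurable_fun_sum _ fun _ _ =>
    (measurable_expTail _ _).const_mul _

theorem Hop.snrPDF_eq (h : Hop L) {n : ℕ} (hn : h.ξ ^ 2 = n) {d : Fin L → ℕ}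
    (hd : ∀ i, 1 ≤ d i ∧ h.b i - h.ξ ^ 2 = d i) {x : ℝ} (hx : 0 < x) :
    h.snrPDF x = h.erlangPDF n d x := by
  have hn0 : 1 ≤ n := by
    have : (0 : ℝ) < n := hn ▸ pow_pos h.ξ_pos 2
    exact_mod_cast this
  have hA := mul_pos h.A0_pos h.avgSNR_pos
  refine Finset.sum_congr rfl fun i _ => ?_
  have hc := h.c_pos i
  rw [(hd i).2, upperGamma_natCast (hd i).1 (mul_pos (h.rate_pos i) hx).le, Finset.mul_sum]
  refine Finset.sum_congr rfl fun k _ => ?_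
  rw [Hop.Xi, Real.rpow_add_natCast hc.ne', Real.rpow_add_natCast hA.ne',
    show x ^ (h.ξ ^ 2 - 1) = x ^ (n - 1) by
      rw [hn, ← Nat.cast_one, ← Nat.cast_sub hn0, Real.rpow_natCast],
    show n + k - 1 = (n - 1) + k by omega, pow_add, mul_pow]
  rw [show h.rate i ^ k = h.c i ^ k / (h.A0 * h.avgSNR) ^ k by rw [Hop.rate, div_pow]]
  have hk : (k.factorial : ℝ) ≠ 0 := by positivity
  have h1 := (Real.rpow_pos_of_pos hA (h.ξ ^ 2)).ne'
  have h2 := (pow_pos hA k).ne'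
  generalize (h.A0 * h.avgSNR) ^ (h.ξ ^ 2) = U at *
  generalize (h.A0 * h.avgSNR) ^ k = V at *
  field_simp

theorem Hop.integrableOn_erlangPDF (h : Hop L) (n : ℕ) (d : Fin L → ℕ) {c : ℝ} (hc : 0 ≤ c) :
    IntegrableOn (h.erlangPDF n d) (Set.Ioi c) :=
  integrable_finsetSum _ fun i _ => integrable_finsetSum _ fun _ _ =>
    (integrableOn_pow_mul_exp (h.rate_pos i) _ hc).const_mul _

theorem Hop.integral_erlangPDF (h : Hop L) (n : ℕ) (d : Fin L → ℕ) {c : ℝ} (hc : 0 ≤ c) :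
    ∫ x in Set.Ioi c, h.erlangPDF n d x = h.erlangTail n d c := by
  unfold erlangPDF erlangTail
  have hint := fun i k => (integrableOn_pow_mul_exp (h.rate_pos i) (n + k - 1) hc).const_mul
    (h.Xi d i k)
  rw [integral_finsetSum _ fun i _ => integrable_finsetSum _ fun k _ => hint i k]
  refine Finset.sum_congr rfl fun i _ => ?_
  rw [integral_finsetSum _ fun k _ => hint i k]
  refine Finset.sum_congr rfl fun k _ => ?_
  rw [integral_const_mul, integral_pow_mul_exp (h.rate_pos i) _ hc]

end FSO

/-! ### Double integrals over the quadrant -/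

/-- Integrability and value are bundled so that the lemma can be nested, once per summation index.
-/
theorem integrable_and_integral_finsetSum {α ι : Type*} [MeasurableSpace α] {m : Measure α}
    {s : Finset ι} {f : ι → α → ℝ} {v : ι → ℝ}
    (h : ∀ i ∈ s, Integrable (f i) m ∧ ∫ x, f i x ∂m = v i) :
    Integrable (fun x => ∑ i ∈ s, f i x) m ∧ ∫ x, ∑ i ∈ s, f i x ∂m = ∑ i ∈ s, v i :=
  ⟨integrable_finsetSum _ fun i hi => (h i hi).1, by
    rw [integral_finsetSum _ fun i hi => (h i hi).1]
    exact Finset.sum_congr rfl fun i hi => (h i hi).2⟩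

theorem integrable_and_integral_besselKernel {a b α μ ν : ℝ} (ha : 0 < a) (hb : 0 < b)
    (hα : 2 * √(a * b) < α) (hp : 0 < μ + ν) (hq : 0 < μ - ν) :
    Integrable (fun zt : ℝ × ℝ => zt.1 ^ (μ - 1) *
        Real.exp (-((α + b * zt.2 + a / zt.2) * zt.1)) * zt.2 ^ (ν - 1))
      ((volume.restrict (Set.Ioi 0)).prod (volume.restrict (Set.Ioi 0))) ∧
    ∫ zt : ℝ × ℝ, zt.1 ^ (μ - 1) *
        Real.exp (-((α + b * zt.2 + a / zt.2) * zt.1)) * zt.2 ^ (ν - 1)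
      ∂((volume.restrict (Set.Ioi 0)).prod (volume.restrict (Set.Ioi 0))) =
      2 * √Real.pi * 4 ^ ν * a ^ ν * Real.Gamma (μ + ν) * Real.Gamma (μ - ν) /
        ((α + 2 * √(a * b)) ^ (μ + ν) * Real.Gamma (μ + 1 / 2)) *
      ordinaryHypergeometric (𝕂 := ℝ) (μ + ν) (ν + 1 / 2) (μ + 1 / 2)
        ((α - 2 * √(a * b)) / (α + 2 * √(a * b))) := by
  have hμ : 0 < μ := by linarith
  have hα0 : 0 < α := (by positivity : (0 : ℝ) ≤ 2 * √(a * b)).trans_lt hα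
  have h := integral_rpow_mul_add_rpow ha hb hα hp hq
  have hg : Measurable fun t : ℝ => t ^ (ν - 1) := by fun_prop
  have hφ : Measurable fun t : ℝ => α + b * t + a / t := by fun_prop
  have hφ0 : ∀ t, 0 < t → 0 < α + b * t + a / t := fun t ht => by positivity
  have hint := integrable_prod_gammaKernel hμ hg hφ hφ0 h.1
  exact ⟨hint, by rw [← h.2, ← integral_integral_gammaKernel hμ hg hφ hφ0 h.1, integral_prod _ hint]⟩

theorem erlang_product_expansion {z t : ℝ} (hz : 0 < z) (ht : 0 < t) (a b P Q : ℝ) (M r : ℕ) :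
    z ^ (P - 1) * Real.exp (-Q * z) * (z * ((z * (1 + t)) ^ M * Real.exp (-(b * (z * (1 + t))))) *
        ((z * (1 + 1 / t)) ^ r * Real.exp (-(a * (z * (1 + 1 / t)))))) =
      ∑ p ∈ Finset.range (M + 1), ∑ s ∈ Finset.range (r + 1),
        ((r.choose s : ℝ) * (M.choose p : ℝ)) * (z ^ (((M : ℝ) + 1 + r + P) - 1) *
          Real.exp (-((a + b + Q + b * t + a / t) * z)) * t ^ (((p : ℝ) - s + 1) - 1)) := by
  have e1 : z ^ (((M : ℝ) + 1 + r + P) - 1) = z ^ (P - 1) * z * z ^ M * z ^ r := by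
    rw [show ((M : ℝ) + 1 + r + P) - 1 = (P - 1) + 1 + M + r by ring, Real.rpow_add_natCast hz.ne',
      Real.rpow_add_natCast hz.ne', Real.rpow_add_one hz.ne']
  have e2 : Real.exp (-((a + b + Q + b * t + a / t) * z)) = Real.exp (-Q * z) *
      Real.exp (-(b * (z * (1 + t)))) * Real.exp (-(a * (z * (1 + 1 / t)))) := by
    rw [← Real.exp_add, ← Real.exp_add]
    congr 1
    field_simp
    ring
  have e3 : ∀ p s : ℕ, t ^ (((p : ℝ) - s + 1) - 1) = t ^ p * (1 / t) ^ s := by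
    intro p s
    rw [add_sub_cancel_right, Real.rpow_sub ht, Real.rpow_natCast, Real.rpow_natCast, one_div,
      inv_pow, div_eq_mul_inv]
  simp_rw [e1, e2, e3]
  rw [mul_pow, mul_pow, add_comm 1 t, add_comm 1 (1 / t), add_pow, add_pow]
  simp only [one_pow, mul_one]
  calc _ = z ^ (P - 1) * z * z ^ M * z ^ r * (Real.exp (-Q * z) *
      Real.exp (-(b * (z * (t + 1)))) * Real.exp (-(a * (z * (1 / t + 1))))) *
      ((∑ p ∈ Finset.range (M + 1), t ^ p * (M.choose p : ℝ)) *
        ∑ s ∈ Finset.range (r + 1), (1 / t) ^ s * (r.choose s : ℝ)) := by ring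
    _ = _ := by
      rw [Finset.sum_mul_sum, Finset.mul_sum]
      refine Finset.sum_congr rfl fun p _ => ?_
      rw [Finset.mul_sum]
      refine Finset.sum_congr rfl fun s _ => ?_
      ring

/-! ### Law of the end-to-end SNR -/

namespace FSO

variable {L : ℕ}

section Law

variable {Ω : Type*} [MeasurableSpace Ω] {μ : Measure Ω} {h : Hop L} {γ : Ω → ℝ} {n : ℕ}
  {d : Fin L → ℕ}

theorem Hop.IsSNR.erlangPDF_nonneg (hγ : h.IsSNR μ γ) (hn : h.ξ ^ 2 = n)
    (hd : ∀ i, 1 ≤ d i ∧ h.b i - h.ξ ^ 2 = d i) {x : ℝ} (hx : 0 < x) : 0 ≤ h.erlangPDF n d x :=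
  h.snrPDF_eq hn hd hx ▸ hγ.pdf_nonneg x hx

theorem Hop.IsSNR.map_eq_erlang (hγ : h.IsSNR μ γ) (hn : h.ξ ^ 2 = n)
    (hd : ∀ i, 1 ≤ d i ∧ h.b i - h.ξ ^ 2 = d i) :
    μ.map γ = (volume.restrict (Set.Ioi (0 : ℝ))).withDensity
      (fun x => ENNReal.ofReal (h.erlangPDF n d x)) := by
  rw [hγ.map_eq]
  refine withDensity_congr_ae ?_
  filter_upwards [ae_restrict_mem measurableSet_Ioi] with x hx
  rw [h.snrPDF_eq hn hd hx]

/-- Single mixture terms may be negative, as `a i` is an arbitrary real; the sign comes from the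
whole density. -/
theorem Hop.IsSNR.erlangTail_nonneg (hγ : h.IsSNR μ γ) (hn : h.ξ ^ 2 = n)
    (hd : ∀ i, 1 ≤ d i ∧ h.b i - h.ξ ^ 2 = d i) {c : ℝ} (hc : 0 < c) : 0 ≤ h.erlangTail n d c := by
  rw [← h.integral_erlangPDF n d hc.le]
  exact setIntegral_nonneg measurableSet_Ioi fun x hx => hγ.erlangPDF_nonneg hn hd (hc.trans hx)

theorem Hop.IsSNR.lintegral_erlangPDF (hγ : h.IsSNR μ γ) (hn : h.ξ ^ 2 = n)
    (hd : ∀ i, 1 ≤ d i ∧ h.b i - h.ξ ^ 2 = d i) {c : ℝ} (hc : 0 < c) :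
    ∫⁻ x in Set.Ioi c, ENNReal.ofReal (h.erlangPDF n d x) =
      ENNReal.ofReal (h.erlangTail n d c) := by
  rw [← h.integral_erlangPDF n d hc.le,
    ofReal_integral_eq_lintegral_ofReal (h.integrableOn_erlangPDF n d hc.le)]
  filter_upwards [ae_restrict_mem measurableSet_Ioi] with x hx
  exact hγ.erlangPDF_nonneg hn hd (hc.trans hx)

end Law

theorem setOf_lt_harmonic_of_lt {y z : ℝ} (hz : 0 < z) (hy : z < y) :
    {x : ℝ | z < x * y / (x + y + 0)} ∩ Set.Ioi 0 = Set.Ioi (z * y / (y - z)) := by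
  have hyz : 0 < y - z := by linarith
  ext x
  simp only [Set.mem_inter_iff, Set.mem_ofPred_eq, Set.mem_Ioi, add_zero]
  constructor
  · rintro ⟨h1, h2⟩
    rw [lt_div_iff₀ (by linarith)] at h1
    rw [div_lt_iff₀ hyz]
    linarith
  · intro h1
    have h2 : 0 < x := lt_trans (div_pos (mul_pos hz (hz.trans hy)) hyz) h1
    refine ⟨?_, h2⟩
    rw [div_lt_iff₀ hyz] at h1
    rw [lt_div_iff₀ (by linarith)]
    linarith

theorem setOf_lt_harmonic_of_le {y z : ℝ} (hy0 : 0 < y) (hy : y ≤ z) :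
    {x : ℝ | z < x * y / (x + y + 0)} ∩ Set.Ioi 0 = ∅ := by
  ext x
  simp only [Set.mem_inter_iff, Set.mem_ofPred_eq, Set.mem_Ioi, add_zero, Set.mem_empty_iff_false,
    iff_false, not_and]
  intro h1 h2
  rw [lt_div_iff₀ (by linarith)] at h1
  nlinarith

theorem setIntegral_Ioi_eq_mul_integral (G : ℝ → ℝ) {z : ℝ} (hz : 0 < z) :
    ∫ y in Set.Ioi z, G y = z * ∫ t in Set.Ioi (0 : ℝ), G (z * (1 + t)) := by
  have h1 := (measurePreserving_add_left volume z).setIntegral_preimage_emb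
    (measurableEmbedding_addLeft z) G (Set.Ioi z)
  have h2 := integral_comp_mul_left_Ioi (fun u => G (z + u)) 0 hz
  rw [Set.preimage_const_add_Ioi, sub_self] at h1
  simp only [mul_zero, smul_eq_mul] at h2
  rw [eq_inv_mul_iff_mul_eq₀ hz.ne', h1] at h2
  rw [← h2]
  simp only [mul_add, mul_one]

theorem measurable_csiSNR {Ω : Type*} [MeasurableSpace Ω] {γ₁ γ₂ : Ω → ℝ} (hm₁ : Measurable γ₁)
    (hm₂ : Measurable γ₂) (q : ℝ) : Measurable (csiSNR q γ₁ γ₂) :=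
  (hm₁.mul hm₂).div ((hm₁.add hm₂).add_const q)

/-- The complementary distribution function of the harmonic-type combination of two independent
positive random variables. -/
theorem measureReal_lt_csiSNR {Ω : Type*} [MeasurableSpace Ω] {μ : Measure Ω}
    [IsProbabilityMeasure μ] {γ₁ γ₂ : Ω → ℝ} (hm₁ : Measurable γ₁) (hm₂ : Measurable γ₂)
    (hindep : IndepFun γ₁ γ₂ μ) {g₁ g₂ T : ℝ → ℝ} (hg₂ : Measurable g₂) (hT : Measurable T)
    (hmap₁ : μ.map γ₁ =
      (volume.restrict (Set.Ioi (0 : ℝ))).withDensity fun x => ENNReal.ofReal (g₁ x))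
    (hmap₂ : μ.map γ₂ =
      (volume.restrict (Set.Ioi (0 : ℝ))).withDensity fun x => ENNReal.ofReal (g₂ x))
    (hg₂0 : ∀ x, 0 < x → 0 ≤ g₂ x) (hT0 : ∀ c, 0 < c → 0 ≤ T c)
    (htail : ∀ c, 0 < c → ∫⁻ x in Set.Ioi c, ENNReal.ofReal (g₁ x) = ENNReal.ofReal (T c))
    {z : ℝ} (hz : 0 < z) :
    μ.real {ω | z < csiSNR 0 γ₁ γ₂ ω} =
      z * ∫ t in Set.Ioi (0 : ℝ), g₂ (z * (1 + t)) * T (z * (1 + 1 / t)) := by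
  set A : Set (ℝ × ℝ) := {p | z < p.1 * p.2 / (p.1 + p.2 + 0)} with hA
  have hAm : MeasurableSet A := measurableSet_lt measurable_const (by fun_prop)
  -- For fixed `y` the slice is a half-line if `y > z` and null otherwise, since `x y / (x + y) <
  -- y`.
  have hslice : ∀ y, 0 < y → μ.map γ₁ ((fun x => (x, y)) ⁻¹' A) =
      (Set.Ioi z).indicator (fun y => ENNReal.ofReal (T (z * y / (y - z)))) y := by
    intro y hy
    have hpre : (fun x => (x, y)) ⁻¹' A = {x : ℝ | z < x * y / (x + y + 0)} := rfl
    have hm : MeasurableSet {x : ℝ | z < x * y / (x + y + 0)} :=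
      measurableSet_lt measurable_const (by fun_prop)
    rw [hpre, hmap₁, withDensity_apply _ hm, Measure.restrict_restrict hm]
    by_cases hyz : z < y
    · rw [setOf_lt_harmonic_of_lt hz hyz, htail _ (div_pos (mul_pos hz hy) (by linarith)),
        Set.indicator_of_mem (Set.mem_Ioi.2 hyz)]
    · rw [setOf_lt_harmonic_of_le hy (not_lt.1 hyz),
        Set.indicator_of_notMem (by simpa using hyz)]
      simp
  have hmeas : μ {ω | z < csiSNR 0 γ₁ γ₂ ω} =
      ∫⁻ y in Set.Ioi z, ENNReal.ofReal (g₂ y * T (z * y / (y - z))) := by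
    have h1 : {ω | z < csiSNR 0 γ₁ γ₂ ω} = (fun ω => (γ₁ ω, γ₂ ω)) ⁻¹' A := rfl
    rw [h1, ← Measure.map_apply (hm₁.prodMk hm₂) hAm,
      hindep.map_prod_eq_prod_map_map hm₁.aemeasurable hm₂.aemeasurable,
      Measure.prod_apply_symm hAm]
    have h2 : Measurable fun y => μ.map γ₁ ((fun x => (x, y)) ⁻¹' A) :=
      measurable_measure_prodMk_right hAm
    rw [hmap₂, lintegral_withDensity_eq_lintegral_mul _ hg₂.ennreal_ofReal h2]
    have h3 : Set.Ioi z = Set.Ioi z ∩ Set.Ioi 0 := by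
      rw [Set.inter_eq_left.2 (Set.Ioi_subset_Ioi hz.le)]
    rw [h3, ← Measure.restrict_restrict (measurableSet_Ioi (a := z)),
      ← lintegral_indicator (measurableSet_Ioi (a := z))]
    refine setLIntegral_congr_fun measurableSet_Ioi fun y hy => ?_
    simp only [Pi.mul_apply]
    rw [hslice y hy]
    by_cases hyz : y ∈ Set.Ioi z
    · rw [Set.indicator_of_mem hyz, Set.indicator_of_mem hyz, ENNReal.ofReal_mul (hg₂0 y hy)]
    · rw [Set.indicator_of_notMem hyz, Set.indicator_of_notMem hyz, mul_zero]
  rw [Measure.real, hmeas, ← integral_eq_lintegral_of_nonneg_ae, setIntegral_Ioi_eq_mul_integral _ hz]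
  · congr 1
    refine setIntegral_congr_fun measurableSet_Ioi fun t ht => ?_
    have ht : 0 < t := ht
    have : z * (z * (1 + t)) / (z * (1 + t) - z) = z * (1 + 1 / t) := by
      rw [show z * (1 + t) - z = z * t by ring]
      field_simp
      ring
    rw [this]
  · filter_upwards [ae_restrict_mem measurableSet_Ioi] with y hy
    have hy : z < y := hy
    exact mul_nonneg (hg₂0 y (hz.trans hy))
      (hT0 _ (div_pos (mul_pos hz (hz.trans hy)) (by linarith)))
  · exact (hg₂.mul (hT.comp (by fun_prop))).aestronglyMeasurable

/-- A distribution function lies in `[0, 1]`, so the Gamma kernel dominates. -/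
theorem integrableOn_aberIntegrand {P Q : ℝ} (hP : 0 < P) (hQ : 0 < Q) (ν : Measure ℝ) :
    IntegrableOn (aberIntegrand P Q (cdf ν)) (Set.Ioi 0) := by
  refine (integrableOn_rpow_mul_exp_neg_mul_Ioi hP hQ).mono' ?_ ?_
  · exact (Measurable.mul (by fun_prop) (monotone_cdf ν).measurable).aestronglyMeasurable
  · filter_upwards [ae_restrict_mem measurableSet_Ioi] with z hz
    have hz : 0 < z := hz
    rw [aberIntegrand, Real.norm_of_nonneg (mul_nonneg (by positivity) (cdf_nonneg ν z)), neg_mul]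
    exact mul_le_of_le_one_right (by positivity) (cdf_le_one ν z)

/-- The average bit-error rate in terms of the complementary distribution function. -/
theorem aber_eq_half_sub {Ω : Type*} [MeasurableSpace Ω] {μ : Measure Ω} [IsProbabilityMeasure μ]
    {P Q : ℝ} (hP : 0 < P) (hQ : 0 < Q) {X : Ω → ℝ} (hX : Measurable X) :
    aber P Q (cdf (μ.map X)) = 1 / 2 - ∫ z in Set.Ioi (0 : ℝ),
      Q ^ P / (2 * Real.Gamma P) * (z ^ (P - 1) * Real.exp (-Q * z) * μ.real {ω | z < X ω}) := by
  have : IsProbabilityMeasure (μ.map X) := Measure.isProbabilityMeasure_map hX.aemeasurable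
  have hc : ∀ z, μ.real {ω | z < X ω} = 1 - cdf (μ.map X) z := by
    intro z
    rw [cdf_eq_real, map_measureReal_apply hX measurableSet_Iic,
      ← probReal_compl_eq_one_sub (hX measurableSet_Iic)]
    congr 1
    ext ω
    simp
  have hw := integrableOn_rpow_mul_exp_neg_mul_Ioi hP hQ
  have hF := integrableOn_aberIntegrand hP hQ (μ.map X)
  have hval := Real.integral_rpow_mul_exp_neg_mul_Ioi hP hQ
  have hG := (Real.Gamma_pos_of_pos hP).ne'
  have hQP := (Real.rpow_pos_of_pos hQ P).ne'
  have e : ∀ z : ℝ, z ^ (P - 1) * Real.exp (-Q * z) * μ.real {ω | z < X ω} =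
      z ^ (P - 1) * Real.exp (-(Q * z)) - aberIntegrand P Q (cdf (μ.map X)) z := by
    intro z
    rw [hc, aberIntegrand, neg_mul]
    ring
  simp_rw [e]
  rw [integral_const_mul, integral_sub hw hF, hval, aber, one_div Q, Real.inv_rpow hQ.le]
  field_simp
  ring

end FSO

/-! ### Assembling the closed form -/

namespace FSO

theorem expTail_eq_sum (a : ℝ) {m : ℕ} (hm : 1 ≤ m) (c : ℝ) :
    expTail a (m - 1) c = ∑ r ∈ Finset.range m,
      ((m - 1).factorial : ℝ) * a ^ ((r : ℤ) - m) / r.factorial *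
        (c ^ r * Real.exp (-(a * c))) := by
  obtain ⟨m, rfl⟩ := Nat.exists_eq_add_of_le' hm
  simp [expTail]

/-- AM-GM with slack `Q`; it places the hypergeometric argument in `(0, 1)`. -/
theorem two_sqrt_mul_lt {a b Q : ℝ} (ha : 0 < a) (hb : 0 < b) (hQ : 0 < Q) :
    2 * √(a * b) < a + b + Q := by
  rw [Real.sqrt_mul ha.le]
  nlinarith [sq_nonneg (√a - √b), Real.sq_sqrt ha.le, Real.sq_sqrt hb.le]

/-- The contribution of one pair of Erlang terms to the average bit-error rate. -/
theorem integral_erlang_product {a b P Q : ℝ} (ha : 0 < a) (hb : 0 < b) (hP : 0 < P) (hQ : 0 < Q)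
    (C : ℝ) (M r : ℕ) :
    Integrable (fun zt : ℝ × ℝ => C * (zt.1 ^ (P - 1) * Real.exp (-Q * zt.1) * (zt.1 *
        ((zt.1 * (1 + zt.2)) ^ M * Real.exp (-(b * (zt.1 * (1 + zt.2))))) *
        ((zt.1 * (1 + 1 / zt.2)) ^ r * Real.exp (-(a * (zt.1 * (1 + 1 / zt.2))))))))
      ((volume.restrict (Set.Ioi 0)).prod (volume.restrict (Set.Ioi 0))) ∧
    ∫ zt : ℝ × ℝ, C * (zt.1 ^ (P - 1) * Real.exp (-Q * zt.1) * (zt.1 *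
        ((zt.1 * (1 + zt.2)) ^ M * Real.exp (-(b * (zt.1 * (1 + zt.2))))) *
        ((zt.1 * (1 + 1 / zt.2)) ^ r * Real.exp (-(a * (zt.1 * (1 + 1 / zt.2)))))))
      ∂((volume.restrict (Set.Ioi 0)).prod (volume.restrict (Set.Ioi 0))) =
      ∑ p ∈ Finset.range (M + 1), ∑ s ∈ Finset.range (r + 1),
        C * ((r.choose s : ℝ) * (M.choose p : ℝ)) *
          (2 * √Real.pi * 4 ^ ((p : ℝ) - s + 1) * a ^ ((p : ℝ) - s + 1) *
            Real.Gamma ((M : ℝ) + 1 + r + P + (p - s + 1)) *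
            Real.Gamma ((M : ℝ) + 1 + r + P - (p - s + 1)) /
            ((a + b + Q + 2 * √(a * b)) ^ ((M : ℝ) + 1 + r + P + (p - s + 1)) *
              Real.Gamma ((M : ℝ) + 1 + r + P + 1 / 2)) *
            ordinaryHypergeometric (𝕂 := ℝ) ((M : ℝ) + 1 + r + P + (p - s + 1))
              ((p : ℝ) - s + 1 + 1 / 2) ((M : ℝ) + 1 + r + P + 1 / 2)
              ((a + b + Q - 2 * √(a * b)) / (a + b + Q + 2 * √(a * b)))) := by
  have key := integrable_and_integral_finsetSum
    (m := (volume.restrict (Set.Ioi (0 : ℝ))).prod (volume.restrict (Set.Ioi (0 : ℝ))))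
    (s := Finset.range (M + 1)) fun p hp => integrable_and_integral_finsetSum
    (s := Finset.range (r + 1)) fun s hs => by
      have hp : (p : ℝ) ≤ M := by exact_mod_cast Nat.lt_succ_iff.1 (Finset.mem_range.1 hp)
      have hs : (s : ℝ) ≤ r := by exact_mod_cast Nat.lt_succ_iff.1 (Finset.mem_range.1 hs)
      have hp0 : (0 : ℝ) ≤ p := p.cast_nonneg
      have hs0 : (0 : ℝ) ≤ s := s.cast_nonneg
      have := integrable_and_integral_besselKernel (μ := (M : ℝ) + 1 + r + P)
        (ν := (p : ℝ) - s + 1) ha hb (two_sqrt_mul_lt ha hb hQ) (by linarith) (by linarith)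
      exact ⟨this.1.const_mul (C * ((r.choose s : ℝ) * (M.choose p : ℝ))), by
        rw [integral_const_mul, this.2]⟩
  have hae : (fun zt : ℝ × ℝ => C * (zt.1 ^ (P - 1) * Real.exp (-Q * zt.1) * (zt.1 *
        ((zt.1 * (1 + zt.2)) ^ M * Real.exp (-(b * (zt.1 * (1 + zt.2))))) *
        ((zt.1 * (1 + 1 / zt.2)) ^ r * Real.exp (-(a * (zt.1 * (1 + 1 / zt.2)))))))) =ᵐ[
      (volume.restrict (Set.Ioi 0)).prod (volume.restrict (Set.Ioi 0))]
      fun zt => ∑ p ∈ Finset.range (M + 1), ∑ s ∈ Finset.range (r + 1),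
        C * ((r.choose s : ℝ) * (M.choose p : ℝ)) * (zt.1 ^ (((M : ℝ) + 1 + r + P) - 1) *
          Real.exp (-((a + b + Q + b * zt.2 + a / zt.2) * zt.1)) *
            zt.2 ^ (((p : ℝ) - s + 1) - 1)) := by
    rw [Measure.prod_restrict]
    filter_upwards [ae_restrict_mem (measurableSet_Ioi.prod measurableSet_Ioi)] with zt hzt
    rw [erlang_product_expansion hzt.1 hzt.2, Finset.mul_sum]
    refine Finset.sum_congr rfl fun p _ => ?_
    rw [Finset.mul_sum]
    exact Finset.sum_congr rfl fun s _ => by ring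
  exact ⟨key.1.congr hae.symm, (integral_congr_ae hae).trans key.2⟩

/-- The integrand of the average bit-error rate as a sum over pairs of Erlang terms. -/
theorem erlang_integrand_eq_sum {L : ℕ} (h₁ h₂ : Hop L) {n₁ : ℕ} (hn₁ : 1 ≤ n₁) (n₂ : ℕ)
    (d₁ d₂ : Fin L → ℕ) (P Q z t : ℝ) :
    Q ^ P / (2 * Real.Gamma P) * (z ^ (P - 1) * Real.exp (-Q * z) *
      (z * (h₂.erlangPDF n₂ d₂ (z * (1 + t)) * h₁.erlangTail n₁ d₁ (z * (1 + 1 / t))))) =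
      ∑ i₁, ∑ k₁ ∈ Finset.range (d₁ i₁), ∑ r₁ ∈ Finset.range (n₁ + k₁), ∑ i₂,
        ∑ k₂ ∈ Finset.range (d₂ i₂), Q ^ P / (2 * Real.Gamma P) * (h₁.Xi d₁ i₁ k₁ *
          (((n₁ + k₁ - 1).factorial : ℝ) * h₁.rate i₁ ^ ((r₁ : ℤ) - (n₁ + k₁ : ℕ)) /
            r₁.factorial) * h₂.Xi d₂ i₂ k₂) * (z ^ (P - 1) * Real.exp (-Q * z) * (z *
        ((z * (1 + t)) ^ (n₂ + k₂ - 1) * Real.exp (-(h₂.rate i₂ * (z * (1 + t))))) *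
        ((z * (1 + 1 / t)) ^ r₁ * Real.exp (-(h₁.rate i₁ * (z * (1 + 1 / t))))))) := by
  rw [mul_comm (h₂.erlangPDF _ _ _), Hop.erlangTail, Finset.sum_mul,
    Finset.mul_sum, Finset.mul_sum, Finset.mul_sum]
  refine Finset.sum_congr rfl fun i₁ _ => ?_
  rw [Finset.sum_mul, Finset.mul_sum, Finset.mul_sum, Finset.mul_sum]
  refine Finset.sum_congr rfl fun k₁ _ => ?_
  rw [expTail_eq_sum _ (by omega), Finset.mul_sum, Finset.sum_mul, Finset.mul_sum,
    Finset.mul_sum, Finset.mul_sum]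
  refine Finset.sum_congr rfl fun r₁ _ => ?_
  rw [Hop.erlangPDF, Finset.mul_sum, Finset.mul_sum, Finset.mul_sum, Finset.mul_sum]
  refine Finset.sum_congr rfl fun i₂ _ => ?_
  rw [Finset.mul_sum, Finset.mul_sum, Finset.mul_sum, Finset.mul_sum]
  refine Finset.sum_congr rfl fun k₂ _ => ?_
  ring

end FSO

theorem proposition1 {L : ℕ} (h₁ h₂ : FSO.Hop L)
    -- `n₁ = ξ₁²`, `n₂ = ξ₂²` are integers, and so are `d₁ i = b_i - ξ₁² ≥ 1`, `d₂ i = b_i - ξ₂² ≥ 1`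
    (n₁ n₂ : ℕ) (hn₁ : h₁.ξ ^ 2 = n₁) (hn₂ : h₂.ξ ^ 2 = n₂)
    (d₁ d₂ : Fin L → ℕ)
    (hd₁ : ∀ i, 1 ≤ d₁ i ∧ h₁.b i - h₁.ξ ^ 2 = d₁ i)
    (hd₂ : ∀ i, 1 ≤ d₂ i ∧ h₂.b i - h₂.ξ ^ 2 = d₂ i)
    {Ω : Type*} [MeasurableSpace Ω] (μ : MeasureTheory.Measure Ω)
    [MeasureTheory.IsProbabilityMeasure μ]
    (γ₁ γ₂ : Ω → ℝ) (hγ₁ : h₁.IsSNR μ γ₁) (hγ₂ : h₂.IsSNR μ γ₂)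
    (hindep : ProbabilityTheory.IndepFun γ₁ γ₂ μ)
    (P Q : ℝ) (hP : 0 < P) (hQ : 0 < Q) :
    MeasureTheory.IntegrableOn
      (FSO.aberIntegrand P Q (ProbabilityTheory.cdf (μ.map (FSO.csiSNR 0 γ₁ γ₂))))
      (Set.Ioi 0) ∧
    FSO.aber P Q (ProbabilityTheory.cdf (μ.map (FSO.csiSNR 0 γ₁ γ₂))) =
      1 / 2 -
        ∑ i₁ : Fin L, ∑ k₁ ∈ Finset.range (d₁ i₁), ∑ r₁ ∈ Finset.range (n₁ + k₁),
        ∑ i₂ : Fin L, ∑ k₂ ∈ Finset.range (d₂ i₂), ∑ p ∈ Finset.range (n₂ + k₂),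
        ∑ s ∈ Finset.range (r₁ + 1),
          ((r₁.choose s : ℝ) * ((n₂ + k₂ - 1).choose p : ℝ)) *
          (Q ^ P / Real.Gamma P) *
          ((h₁.Xi d₁ i₁ k₁ * h₂.Xi d₂ i₂ k₂ * (Nat.factorial (n₁ + k₁ - 1) : ℝ) *
              √Real.pi * (4 : ℝ) ^ ((p : ℤ) - s + 1) *
              h₁.rate i₁ ^ ((p : ℤ) - s + r₁ - n₁ - k₁ + 1) *
              Real.Gamma (n₂ + k₂ + r₁ + p - s + P + 1) *
              Real.Gamma (n₂ + k₂ + r₁ - p + s + P - 1)) /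
            ((Nat.factorial r₁ : ℝ) *
              (h₁.rate i₁ + h₂.rate i₂ + Q + 2 * √(h₁.rate i₁ * h₂.rate i₂)) ^
                ((n₂ : ℝ) + k₂ + r₁ + p - s + P + 1) *
              Real.Gamma (n₂ + k₂ + r₁ + P + 1 / 2))) *
          ordinaryHypergeometric (𝕂 := ℝ)
            ((n₂ : ℝ) + k₂ + r₁ + p - s + P + 1) ((p : ℝ) - s + 3 / 2)
            ((n₂ : ℝ) + k₂ + r₁ + P + 1 / 2)
            ((h₁.rate i₁ + h₂.rate i₂ + Q - 2 * √(h₁.rate i₁ * h₂.rate i₂)) /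
              (h₁.rate i₁ + h₂.rate i₂ + Q + 2 * √(h₁.rate i₁ * h₂.rate i₂))) := by
  have hn₁0 : 1 ≤ n₁ := by
    have : (0 : ℝ) < n₁ := hn₁ ▸ pow_pos h₁.ξ_pos 2
    exact_mod_cast this
  have hn₂0 : 1 ≤ n₂ := by
    have : (0 : ℝ) < n₂ := hn₂ ▸ pow_pos h₂.ξ_pos 2
    exact_mod_cast this
  have hX := FSO.measurable_csiSNR hγ₁.measurable hγ₂.measurable 0
  refine ⟨FSO.integrableOn_aberIntegrand hP hQ _, ?_⟩
  rw [FSO.aber_eq_half_sub hP hQ hX]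
  congr 1
  have key := integrable_and_integral_finsetSum (s := Finset.univ) fun i₁ _ =>
    integrable_and_integral_finsetSum (s := Finset.range (d₁ i₁)) fun k₁ _ =>
    integrable_and_integral_finsetSum (s := Finset.range (n₁ + k₁)) fun r₁ _ =>
    integrable_and_integral_finsetSum (s := Finset.univ) fun i₂ _ =>
    integrable_and_integral_finsetSum (s := Finset.range (d₂ i₂)) fun k₂ _ =>
    FSO.integral_erlang_product (h₁.rate_pos i₁) (h₂.rate_pos i₂) hP hQ
      (Q ^ P / (2 * Real.Gamma P) * (h₁.Xi d₁ i₁ k₁ * (((n₁ + k₁ - 1).factorial : ℝ) *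
        h₁.rate i₁ ^ ((r₁ : ℤ) - (n₁ + k₁ : ℕ)) / r₁.factorial) * h₂.Xi d₂ i₂ k₂))
      (n₂ + k₂ - 1) r₁
  have hinner : ∀ z : ℝ, 0 < z → Q ^ P / (2 * Real.Gamma P) * (z ^ (P - 1) * Real.exp (-Q * z) *
      μ.real {ω | z < FSO.csiSNR 0 γ₁ γ₂ ω}) = ∫ t in Set.Ioi (0 : ℝ), Q ^ P / (2 * Real.Gamma P) *
      (z ^ (P - 1) * Real.exp (-Q * z) *
      (z * (h₂.erlangPDF n₂ d₂ (z * (1 + t)) * h₁.erlangTail n₁ d₁ (z * (1 + 1 / t))))) := by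
    intro z hz
    rw [FSO.measureReal_lt_csiSNR hγ₁.measurable hγ₂.measurable hindep
      (h₂.measurable_erlangPDF n₂ d₂) (h₁.measurable_erlangTail n₁ d₁)
      (hγ₁.map_eq_erlang hn₁ hd₁) (hγ₂.map_eq_erlang hn₂ hd₂)
      (fun x hx => hγ₂.erlangPDF_nonneg hn₂ hd₂ hx)
      (fun c hc => hγ₁.erlangTail_nonneg hn₁ hd₁ hc)
      (fun c hc => hγ₁.lintegral_erlangPDF hn₁ hd₁ hc) hz,
      integral_const_mul, integral_const_mul, integral_const_mul]
  rw [setIntegral_congr_fun measurableSet_Ioi hinner]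
  simp_rw [FSO.erlang_integrand_eq_sum h₁ h₂ hn₁0]
  rw [integral_prod _ key.1] at key
  refine key.2.trans ?_
  refine Finset.sum_congr rfl fun i₁ _ => Finset.sum_congr rfl fun k₁ _ =>
    Finset.sum_congr rfl fun r₁ _ => Finset.sum_congr rfl fun i₂ _ =>
    Finset.sum_congr rfl fun k₂ _ => ?_
  -- The truncated subtraction is harmless because `n₂ ≥ 1`; hence `M + 1 + r + P` is `N + P`.
  have hM : n₂ + k₂ - 1 + 1 = n₂ + k₂ := by omega
  have hM' : ((n₂ + k₂ - 1 : ℕ) : ℝ) + 1 = n₂ + k₂ := by exact_mod_cast hM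
  rw [hM, hM']
  refine Finset.sum_congr rfl fun p _ => Finset.sum_congr rfl fun s _ => ?_
  have ha := h₁.rate_pos i₁
  have e1 : (4 : ℝ) ^ ((p : ℝ) - s + 1) = (4 : ℝ) ^ ((p : ℤ) - s + 1) := by
    rw [← Real.rpow_intCast]; push_cast; rfl
  -- One power of the rate comes from the tail coefficient of the first hop, the other from the
  -- factor `a ^ ν` of the Mellin-type integral.
  have e2 : h₁.rate i₁ ^ ((p : ℤ) - s + r₁ - n₁ - k₁ + 1) =
      h₁.rate i₁ ^ ((r₁ : ℤ) - (n₁ + k₁ : ℕ)) * h₁.rate i₁ ^ ((p : ℝ) - s + 1) := by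
    rw [show (p : ℝ) - s + 1 = (((p : ℤ) - s + 1 : ℤ) : ℝ) by push_cast; ring, Real.rpow_intCast,
      ← zpow_add₀ ha.ne']
    congr 1
    push_cast
    ring
  rw [e1, e2, show (n₂ : ℝ) + k₂ + r₁ + P + (p - s + 1) = n₂ + k₂ + r₁ + p - s + P + 1 by ring,
    show (n₂ : ℝ) + k₂ + r₁ + P - (p - s + 1) = n₂ + k₂ + r₁ - p + s + P - 1 by ring,
    show (p : ℝ) - s + 1 + 1 / 2 = p - s + 3 / 2 by ring]
  -- The 2 in `2 * √π` cancels the one in `Q ^ P / (2 Γ(P))`.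
  ring
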